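/- Let $X$ be a smooth $d$-dimensional (second countable, boundaryless) Riemannian manifold whose Riemannian distance $d(\cdot,\cdot)$ is finite, with Riemannian volume measure $\mathrm{vol}$. Assume that * $X$ has polynomial volume growth: there are $A,\nu>0$ with $\mathrm{vol}(B_R(x))\le A(1+R)^\nu$ for all $x\in X$, $R\ge 0$; * the volume of small balls is bounded below: there are $v,r_0>0$ with $\mathrm{vol}(B_\rho(x))\ge v\rho^d$ for all $x\in X$, $0\le\rho\le r_0$. For a metric space $Y$ and a Hilbert space $\mathscr H$ with a $*$-representation of $C_0(Y)$, the Roe algebra $C^*(Y,\mathscr H)$ is the norm closure in $\mathcal B(\mathscr H)$ of the $*$-algebra of operators $T$ that are locally compact ($fT$ and $Tf$ are compact for all $f\in C_0(Y)$ of compact support) and of finite propagation (for some $R>0$ one has $fTg=0$ whenever the supports of $f,g\in C_0(Y)$ are at distance $\geq R$). The module $\mathscr H$ is ample if $\mathscr H$ is separable, the representation is non-degenerate, and no non-zero $f\in C_0(Y)$ acts as a compact operator. Write $C^*(X)=C^*(X,L^2(X,\mathrm{vol}))$ for the action of $C_0(X)$ by pointwise multiplication. $K_0$ denotes the $K_0$-group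 of a (not necessarily unital) $C^*$-algebra. Assume moreover that $X=X_1\cup X_2$ with $X_1,X_2\subseteq X$ closed, and that $K_0(C^*(X_i))=0$ for $i=1,2$, where $X_i$ carries the restricted metric and $C^*(X_i)=C^*(X_i,\mathscr H_i)$ for some ample module $\mathscr H_i$ over $X_i$. Let $p\in C^*(X)$ be a projection (a self-adjoint idempotent) with $[p]\neq 0$ in $K_0(C^*(X))$. Let $\Gamma\subseteq X$ be any uniformly discrete subset, i.e. for some $r>0$ the open balls $B_r(\gamma)$, $\gamma\in\Gamma$, are pairwise disjoint. Then the range of $p$ has no $\Gamma$-uniformly localized Wannier basis: there is no orthonormal basis $\{w_\gamma\}_{\gamma\in\Gamma}$ of the range $pL^2(X)$ such that for every $\mu>0$ there is a constant $C_\mu>0$ with $$|w_\gamma(x)|\le C_\mu\,(1+d(x,\gamma))^{-\mu}\qquad\text{for all }\gamma\in\Gamma\text{ and almost all }x\in X.$$ -/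

import Mathlib

open MeasureTheory Manifold Bundle Matrix
open scoped ENNReal ContDiff ZeroAtInfty

noncomputable section

/-! ## `K`-theory of `C⋆`-algebras: projections over matrix algebras -/

namespace KTheory

section Unital

variable (R : Type*) [Ring R] [StarRing R]

/-- A projection (self-adjoint idempotent) in some matrix algebra over `R`. The rows and columns
are indexed by an arbitrary finite type (rather than only by `Fin n`), so that the orthogonal sum
of projections is a block matrix; up to reindexing this is a projection in `Mₙ(R)`. -/
structure MatProj where
  /-- the index type of the rows and columns -/
  ι : Type
  fin : Fintype ι
  /-- the matrix -/
  mat : Matrix ι ι R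
  idem : mat * mat = mat
  selfAdj : matᴴ = mat

attribute [instance] MatProj.fin

variable {R}

/-- Murray--von Neumann equivalence of projections in matrix algebras of possibly different sizes:
there is a rectangular matrix `v` with `v v⋆ = p` and `v⋆ v = q`. -/
def MvN (p q : MatProj R) : Prop :=
  ∃ v : Matrix p.ι q.ι R, v * vᴴ = p.mat ∧ vᴴ * v = q.mat

variable (R) in
/-- Murray--von Neumann equivalence as a setoid. -/
instance mvnSetoid : Setoid (MatProj R) where
  r := MvN
  iseqv :=
    { refl := fun p => ⟨p.mat, by rw [p.selfAdj, p.idem], by rw [p.selfAdj, p.idem]⟩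
      symm := by
        rintro p q ⟨v, h₁, h₂⟩
        exact ⟨vᴴ, by rw [conjTranspose_conjTranspose, h₂], by rw [conjTranspose_conjTranspose, h₁]⟩
      trans := by
        rintro p q r ⟨v, h₁, h₂⟩ ⟨w, h₃, h₄⟩
        refine ⟨v * w, ?_, ?_⟩
        · calc v * w * (v * w)ᴴ = v * (w * wᴴ) * vᴴ := by
                rw [conjTranspose_mul]; simp only [Matrix.mul_assoc]
            _ = (v * vᴴ) * (v * vᴴ) := by rw [h₃, ← h₂]; simp only [Matrix.mul_assoc]
            _ = p.mat := by rw [h₁, p.idem]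
        · calc (v * w)ᴴ * (v * w) = wᴴ * (vᴴ * v) * w := by
                rw [conjTranspose_mul]; simp only [Matrix.mul_assoc]
            _ = (wᴴ * w) * (wᴴ * w) := by rw [h₂, ← h₃]; simp only [Matrix.mul_assoc]
            _ = r.mat := by rw [h₄, r.idem] }

/-- The orthogonal sum `diag(p, q)`. -/
def MatProj.add (p q : MatProj R) : MatProj R where
  ι := p.ι ⊕ q.ι
  fin := inferInstance
  mat := fromBlocks p.mat 0 0 q.mat
  idem := by simp [fromBlocks_multiply, p.idem, q.idem]
  selfAdj := by simp [fromBlocks_conjTranspose, p.selfAdj, q.selfAdj]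

variable (R) in
/-- The projection of size zero. -/
def MatProj.zero : MatProj R := ⟨Empty, inferInstance, 0, by simp, by simp⟩

theorem MatProj.add_congr {p p' q q' : MatProj R} (h : p ≈ p') (h' : q ≈ q') :
    p.add q ≈ p'.add q' := by
  obtain ⟨v, h₁, h₂⟩ := h
  obtain ⟨w, h₃, h₄⟩ := h'
  refine ⟨(fromBlocks v 0 0 w : Matrix (p.ι ⊕ q.ι) (p'.ι ⊕ q'.ι) R), ?_, ?_⟩
  · change _ = fromBlocks p.mat 0 0 q.mat
    erw [fromBlocks_conjTranspose, fromBlocks_multiply]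
    simp [h₁, h₃]
  · change _ = fromBlocks p'.mat 0 0 q'.mat
    erw [fromBlocks_conjTranspose, fromBlocks_multiply]
    simp [h₂, h₄]

/-- Reindexing a projection does not change its class. -/
theorem MatProj.equiv_of_submatrix {p q : MatProj R} (e : p.ι ≃ q.ι)
    (h : p.mat = q.mat.submatrix e e) : p ≈ q := by
  refine ⟨q.mat.submatrix e (Equiv.refl _), ?_, ?_⟩
  · rw [conjTranspose_submatrix, submatrix_mul_equiv, q.selfAdj, q.idem, h]
  · rw [conjTranspose_submatrix, submatrix_mul_equiv, q.selfAdj, q.idem]; simp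

theorem MatProj.add_comm_equiv (p q : MatProj R) : p.add q ≈ q.add p := by
  refine MatProj.equiv_of_submatrix (Equiv.sumComm p.ι q.ι) ?_
  ext i j
  rcases i with i | i <;> rcases j with j | j <;> rfl

theorem MatProj.add_zero_equiv (p : MatProj R) : p.add (MatProj.zero R) ≈ p := by
  refine MatProj.equiv_of_submatrix (Equiv.sumEmpty p.ι Empty) ?_
  ext i j
  rcases i with i | i
  · rcases j with j | j
    · rfl
    · exact j.elim
  · exact i.elim

theorem MatProj.add_assoc_equiv (p q r : MatProj R) :
    (p.add q).add r ≈ p.add (q.add r) := by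
  refine MatProj.equiv_of_submatrix (Equiv.sumAssoc p.ι q.ι r.ι) ?_
  ext i j
  rcases i with (i | i) | i <;> rcases j with (j | j) | j <;> rfl

variable (R) in
/-- `V(R)`: Murray--von Neumann classes of projections in matrices over `R`. -/
def VMonoid : Type _ := Quotient (mvnSetoid R)

instance : Add (VMonoid R) :=
  ⟨Quotient.map₂ MatProj.add (fun _ _ h _ _ h' => MatProj.add_congr h h')⟩

instance : Zero (VMonoid R) := ⟨Quotient.mk _ (MatProj.zero R)⟩

/-- The commutative monoid structure on `V(R)` given by orthogonal sum. -/
instance : AddCommMonoid (VMonoid R) where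
  add_assoc := by
    rintro ⟨p⟩ ⟨q⟩ ⟨r⟩
    exact Quotient.sound (MatProj.add_assoc_equiv p q r)
  add_comm := by
    rintro ⟨p⟩ ⟨q⟩
    exact Quotient.sound (MatProj.add_comm_equiv p q)
  add_zero := by
    rintro ⟨p⟩
    exact Quotient.sound (MatProj.add_zero_equiv p)
  zero_add := by
    rintro ⟨p⟩
    exact Quotient.sound
      (Setoid.trans (MatProj.add_comm_equiv (MatProj.zero R) p) (MatProj.add_zero_equiv p))
  nsmul := nsmulRec

variable (R) in
/-- `K₀` of a unital `⋆`-algebra: the Grothendieck group of `V(R)`. -/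
abbrev K0Unital : Type _ := Algebra.GrothendieckAddGroup (VMonoid R)

variable {S : Type*} [Ring S] [StarRing S] [Algebra ℂ R] [Algebra ℂ S]

/-- Entrywise image of a projection under a unital `⋆`-homomorphism. -/
def MatProj.map (φ : R →⋆ₐ[ℂ] S) (p : MatProj R) : MatProj S where
  ι := p.ι
  fin := p.fin
  mat := p.mat.map φ
  idem := by rw [← Matrix.map_mul, p.idem]
  selfAdj := by
    rw [← Matrix.conjTranspose_map φ (fun a => map_star φ a), p.selfAdj]

/-- Functoriality of `V`. -/
def VMonoid.map (φ : R →⋆ₐ[ℂ] S) : VMonoid R →+ VMonoid S where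
  toFun := Quotient.map (MatProj.map φ) (by
    rintro p q ⟨v, h₁, h₂⟩
    refine ⟨v.map φ, ?_, ?_⟩
    · change v.map φ * (v.map φ)ᴴ = p.mat.map φ
      rw [← Matrix.conjTranspose_map φ (fun a => map_star φ a), ← Matrix.map_mul, h₁]
    · change (v.map φ)ᴴ * v.map φ = q.mat.map φ
      rw [← Matrix.conjTranspose_map φ (fun a => map_star φ a), ← Matrix.map_mul, h₂])
  map_zero' := Quotient.sound (MatProj.equiv_of_submatrix (Equiv.refl Empty)
    (by ext i; exact i.elim))
  map_add' := by
    rintro ⟨p⟩ ⟨q⟩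
    refine Quotient.sound (MatProj.equiv_of_submatrix (Equiv.refl (p.ι ⊕ q.ι)) ?_)
    ext i j
    rcases i with i | i <;> rcases j with j | j
    · rfl
    · exact map_zero φ
    · exact map_zero φ
    · rfl

/-- Functoriality of `K₀` for unital `⋆`-homomorphisms. -/
def K0Unital.map (φ : R →⋆ₐ[ℂ] S) : K0Unital R →+ K0Unital S :=
  Algebra.GrothendieckAddGroup.lift (Algebra.GrothendieckAddGroup.of.comp (VMonoid.map φ))

end Unital

section NonUnital

variable (A : Type*) [NonUnitalRing A] [StarRing A] [Module ℂ A] [IsScalarTower ℂ A A]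
  [SMulCommClass ℂ A A] [StarModule ℂ A]

/-- The augmentation `A⁺ → ℂ`, `(z, a) ↦ z`, on the unitization of `A`. -/
def augmentation : Unitization ℂ A →⋆ₐ[ℂ] ℂ := Unitization.starLift (0 : A →⋆ₙₐ[ℂ] ℂ)

set_option linter.unusedSectionVars false in
theorem augmentation_inr (a : A) : augmentation A (a : Unitization ℂ A) = 0 :=
  DFunLike.congr_fun (Unitization.starLift.symm_apply_apply (0 : A →⋆ₙₐ[ℂ] ℂ)) a

/-- `K₀(A)` for a not necessarily unital algebra `A`: the kernel of `K₀(A⁺) → K₀(ℂ)`. -/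
def K0 : AddSubgroup (K0Unital (Unitization ℂ A)) := (K0Unital.map (augmentation A)).ker

variable {A}

/-- The `1 × 1` matrix `(p)` over `A⁺` attached to a projection `p ∈ A`. -/
def projMat (p : A) (hp : IsStarProjection p) : MatProj (Unitization ℂ A) where
  ι := Unit
  fin := inferInstance
  mat := Matrix.of fun _ _ => (p : Unitization ℂ A)
  idem := by
    refine Matrix.ext fun i j => ?_
    simp [Matrix.mul_apply, ← Unitization.inr_mul, hp.isIdempotentElem.eq]
  selfAdj := by
    refine Matrix.ext fun i j => ?_
    simp [Matrix.conjTranspose_apply, ← Unitization.inr_star, hp.isSelfAdjoint.star_eq]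

/-- The class `[p] ∈ K₀(A)` of a projection `p ∈ A`. -/
def K0.mk (p : A) (hp : IsStarProjection p) : K0 A :=
  ⟨Algebra.GrothendieckAddGroup.of (Quotient.mk _ (projMat p hp)), by
    have h : VMonoid.map (augmentation A) (Quotient.mk _ (projMat p hp)) = 0 := by
      refine Quotient.sound ⟨(0 : Matrix Unit Empty ℂ), ?_, ?_⟩
      · refine Matrix.ext fun i j => ?_
        change ((0 : Matrix Unit Empty ℂ) * (0 : Matrix Unit Empty ℂ)ᴴ) i j =
          augmentation A (p : Unitization ℂ A)
        rw [Matrix.zero_mul, augmentation_inr]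
        rfl
      · exact Matrix.ext fun i => i.elim
    have h' : K0Unital.map (augmentation A)
        (Algebra.GrothendieckAddGroup.of (Quotient.mk _ (projMat p hp))) =
        Algebra.GrothendieckAddGroup.of
          (VMonoid.map (augmentation A) (Quotient.mk _ (projMat p hp))) :=
      DFunLike.congr_fun (Algebra.GrothendieckAddGroup.lift.symm_apply_apply
        (Algebra.GrothendieckAddGroup.of.comp (VMonoid.map (augmentation A)))) _
    change K0Unital.map (augmentation A) _ = 0
    rw [h', h, map_zero]⟩

end NonUnital

end KTheory

/-! ## Roe algebras -/

namespace Roe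

section Module

variable {Y : Type*} [MetricSpace Y] {𝓗 : Type*} [NormedAddCommGroup 𝓗] [InnerProductSpace ℂ 𝓗]
  [CompleteSpace 𝓗]

/-- An operator `T` on a Hilbert space with a representation `ρ` of `C₀(Y)` is locally compact if
`T f` and `f T` are compact for all `f` of compact support. -/
def IsLocallyCompact (ρ : C₀(Y, ℂ) →⋆ₙₐ[ℂ] (𝓗 →L[ℂ] 𝓗)) (T : 𝓗 →L[ℂ] 𝓗) : Prop :=
  ∀ f : C₀(Y, ℂ), HasCompactSupport f →
    IsCompactOperator (T * ρ f) ∧ IsCompactOperator (ρ f * T)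

/-- `T` has finite propagation if for some `R > 0` one has `f T g = 0` as soon as the supports of
`f` and `g` are at distance `R` or more. -/
def HasFinitePropagation (ρ : C₀(Y, ℂ) →⋆ₙₐ[ℂ] (𝓗 →L[ℂ] 𝓗)) (T : 𝓗 →L[ℂ] 𝓗) : Prop :=
  ∃ R : ℝ, 0 < R ∧ ∀ f g : C₀(Y, ℂ),
    (∀ x ∈ tsupport f, ∀ y ∈ tsupport g, R ≤ dist x y) → ρ f * T * ρ g = 0

/-- The Roe algebra of the module `(𝓗, ρ)`: the norm closure of the `⋆`-algebra of locally compact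
operators of finite propagation. -/
def algebra (ρ : C₀(Y, ℂ) →⋆ₙₐ[ℂ] (𝓗 →L[ℂ] 𝓗)) : NonUnitalStarSubalgebra ℂ (𝓗 →L[ℂ] 𝓗) :=
  (NonUnitalStarAlgebra.adjoin ℂ
    {T : 𝓗 →L[ℂ] 𝓗 | IsLocallyCompact ρ T ∧ HasFinitePropagation ρ T}).topologicalClosure

/-- An ample module over `Y`: a separable Hilbert space with a non-degenerate representation of
`C₀(Y)` in which no non-zero function acts as a compact operator. -/
structure IsAmple (ρ : C₀(Y, ℂ) →⋆ₙₐ[ℂ] (𝓗 →L[ℂ] 𝓗)) : Prop where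
  separable : TopologicalSpace.SeparableSpace 𝓗
  nondegenerate :
    (Submodule.span ℂ {h : 𝓗 | ∃ (f : C₀(Y, ℂ)) (k : 𝓗), h = ρ f k}).topologicalClosure = ⊤
  not_compact : ∀ f : C₀(Y, ℂ), IsCompactOperator (ρ f) → f = 0

end Module

section L2

variable {X : Type*} [MetricSpace X] [MeasurableSpace X] [BorelSpace X]

theorem memLp_mul {μ : Measure X} (f : C₀(X, ℂ)) (g : Lp ℂ 2 μ) :
    MemLp (fun x => f x * g x) 2 μ := by
  refine MemLp.of_le_mul (c := ‖f‖) (Lp.memLp g)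
    ((map_continuous f).aestronglyMeasurable.mul (Lp.aestronglyMeasurable g)) ?_
  refine Filter.Eventually.of_forall fun x => ?_
  rw [norm_mul]
  exact mul_le_mul_of_nonneg_right (f.toBCF.norm_coe_le_norm x) (norm_nonneg _)

/-- The multiplication operator on `L²(X, μ)` by `f ∈ C₀(X)`. -/
def mulOp (μ : Measure X) (f : C₀(X, ℂ)) : Lp ℂ 2 μ →L[ℂ] Lp ℂ 2 μ :=
  LinearMap.mkContinuous
    { toFun := fun g => (memLp_mul f g).toLp _
      map_add' := fun g h => by
        ext1
        filter_upwards [(memLp_mul f (g + h)).coeFn_toLp, Lp.coeFn_add g h,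
          Lp.coeFn_add ((memLp_mul f g).toLp _) ((memLp_mul f h).toLp _),
          (memLp_mul f g).coeFn_toLp, (memLp_mul f h).coeFn_toLp] with x h₁ h₂ h₃ h₄ h₅
        rw [h₁, h₂, h₃, Pi.add_apply, Pi.add_apply, h₄, h₅, mul_add]
      map_smul' := fun c g => by
        ext1
        filter_upwards [(memLp_mul f (c • g)).coeFn_toLp, Lp.coeFn_smul c g,
          Lp.coeFn_smul c ((memLp_mul f g).toLp _), (memLp_mul f g).coeFn_toLp] with x h₁ h₂ h₃ h₄
        simp only [RingHom.id_apply]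
        rw [h₁, h₂, h₃, Pi.smul_apply, Pi.smul_apply, h₄, smul_eq_mul, smul_eq_mul]
        ring }
    ‖f‖ (fun g => by
      refine Lp.norm_le_mul_norm_of_ae_le_mul ?_
      filter_upwards [(memLp_mul f g).coeFn_toLp] with x h
      simp only [LinearMap.coe_mk, AddHom.coe_mk]
      rw [h, norm_mul]
      exact mul_le_mul_of_nonneg_right (f.toBCF.norm_coe_le_norm x) (norm_nonneg _))

theorem mulOp_ae (μ : Measure X) (f : C₀(X, ℂ)) (g : Lp ℂ 2 μ) :
    mulOp μ f g =ᵐ[μ] fun x => f x * g x :=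
  (memLp_mul f g).coeFn_toLp

/-- The representation of `C₀(X)` on `L²(X, μ)` by pointwise multiplication. -/
def mulRep (μ : Measure X) : C₀(X, ℂ) →⋆ₙₐ[ℂ] (Lp ℂ 2 μ →L[ℂ] Lp ℂ 2 μ) where
  toFun := mulOp μ
  map_smul' c f := by
    ext1 g; ext1
    simp only [MonoidHom.id_apply, _root_.smul_apply]
    filter_upwards [mulOp_ae μ (c • f) g, Lp.coeFn_smul c (mulOp μ f g), mulOp_ae μ f g]
      with x h₁ h₂ h₃
    rw [h₁, h₂, Pi.smul_apply, h₃, ZeroAtInftyContinuousMap.smul_apply, smul_eq_mul, smul_eq_mul,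
      mul_assoc]
  map_zero' := by
    ext1 g; ext1
    simp only [_root_.zero_apply]
    filter_upwards [mulOp_ae μ 0 g, Lp.coeFn_zero ℂ 2 μ] with x h₁ h₂
    rw [h₁, h₂]; simp
  map_add' f f' := by
    ext1 g; ext1
    simp only [_root_.add_apply]
    filter_upwards [mulOp_ae μ (f + f') g, Lp.coeFn_add (mulOp μ f g) (mulOp μ f' g),
      mulOp_ae μ f g, mulOp_ae μ f' g] with x h₁ h₂ h₃ h₄
    rw [h₁, h₂, Pi.add_apply, h₃, h₄, ZeroAtInftyContinuousMap.add_apply, add_mul]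
  map_mul' f f' := by
    ext1 g; ext1
    simp only [mul_apply_eq_comp]
    filter_upwards [mulOp_ae μ (f * f') g, mulOp_ae μ f (mulOp μ f' g), mulOp_ae μ f' g]
      with x h₁ h₂ h₃
    rw [h₁, h₂, h₃, ZeroAtInftyContinuousMap.mul_apply, mul_assoc]
  map_star' f := by
    rw [ContinuousLinearMap.star_eq_adjoint, ContinuousLinearMap.eq_adjoint_iff]
    intro g h
    rw [L2.inner_def, L2.inner_def]
    refine integral_congr_ae ?_
    filter_upwards [mulOp_ae μ (star f) g, mulOp_ae μ f h] with x h₁ h₂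
    rw [h₁, h₂, ZeroAtInftyContinuousMap.star_apply]
    simp [RCLike.inner_apply]
    ring

end L2

end Roe

/-! ## Riemannian volume -/

namespace RiemannianVolume

/-- The derivative `E → T_{e⁻¹(z)} X` of the inverse of a chart `e : X → E` at `z`. -/
def coordDeriv {E : Type*} [NormedAddCommGroup E] [NormedSpace ℝ E] {X : Type*}
    [TopologicalSpace X] [ChartedSpace E X] (e : OpenPartialHomeomorph X E) (z : E) :
    E →L[ℝ] TangentSpace 𝓘(ℝ, E) (e.symm z) :=
  mfderiv 𝓘(ℝ, E) 𝓘(ℝ, E) e.symm z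

variable {d : ℕ} (X : Type*) [MetricSpace X] [ChartedSpace (EuclideanSpace ℝ (Fin d)) X]
  [RiemannianBundle (fun x : X => TangentSpace (𝓡 d) x)]

variable {X} in
/-- The matrix `(g_ij(z))` of the Riemannian metric in the chart `e`, at the point `z` of
the target of `e`: `g_ij = ⟨∂_i, ∂_j⟩`, where `∂_i` is the image of the `i`-th
basis vector under the derivative of `e⁻¹`. -/
def gramMatrix (e : OpenPartialHomeomorph X (EuclideanSpace ℝ (Fin d)))
    (z : EuclideanSpace ℝ (Fin d)) : Matrix (Fin d) (Fin d) ℝ :=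
  Matrix.of fun i j =>
    inner ℝ (coordDeriv e z (EuclideanSpace.single i 1)) (coordDeriv e z (EuclideanSpace.single j 1))

variable [MeasurableSpace X]

variable {X} in
/-- The Riemannian volume on the domain of the chart `e`, i.e. `√(det g_ij) dz` transported to
`X`, extended by zero outside of the domain of `e`. -/
def chartVolume (e : OpenPartialHomeomorph X (EuclideanSpace ℝ (Fin d))) : Measure X :=
  Measure.map e.symm
    ((volume.restrict e.target).withDensity fun z => ENNReal.ofReal √(gramMatrix e z).det)

/-- The Riemannian volume measure, obtained by gluing the measures `√(det g_ij) dz` of all charts: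
the least measure that dominates the volume of every chart domain. As the chart volumes agree on
overlaps and countably many charts cover `X`, this is the unique Borel measure that restricts
to `√(det g_ij) dz` on each chart domain. -/
def vol : Measure X :=
  ⨆ e ∈ atlas (EuclideanSpace ℝ (Fin d)) X, chartVolume e

end RiemannianVolume

/-! ## Volume growth, uniformly discrete sets and localized Wannier bases -/

namespace Wannier

variable {X : Type*} [MetricSpace X] [MeasurableSpace X]

/-- Polynomial volume growth: `vol(B_R(x)) ≤ A (1 + R)^ν` for all `x` and all `R ≥ 0`. -/
def PolynomialGrowth (μ : Measure X) : Prop :=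
  ∃ A ν : ℝ, 0 < A ∧ 0 < ν ∧ ∀ (x : X) (R : ℝ), 0 ≤ R →
    μ (Metric.ball x R) ≤ ENNReal.ofReal (A * (1 + R) ^ ν)

/-- Small balls have volume bounded below: `vol(B_ρ(x)) ≥ v ρ^d` for all `x` and `0 ≤ ρ ≤ r₀`. -/
def SmallBallsBoundedBelow (d : ℕ) (μ : Measure X) : Prop :=
  ∃ v r₀ : ℝ, 0 < v ∧ 0 < r₀ ∧ ∀ (x : X) (ρ : ℝ), 0 ≤ ρ → ρ ≤ r₀ →
    ENNReal.ofReal (v * ρ ^ d) ≤ μ (Metric.ball x ρ)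

/-- `Γ` is uniformly discrete: for some `r > 0` the open balls `B_r(γ)`, `γ ∈ Γ`, are pairwise
disjoint. -/
def UniformlyDiscrete (Γ : Set X) : Prop :=
  ∃ r : ℝ, 0 < r ∧ Γ.PairwiseDisjoint fun γ => Metric.ball γ r

/-- `w` is a `Γ`-uniformly localized Wannier basis of the subspace `S ⊆ L²(X, μ)`: an orthonormal
basis of `S` such that for each `m > 0` there is one constant `C` with
`|w_γ(x)| ≤ C (1 + d(x, γ))^(-m)` for all `γ` and almost all `x`. -/
structure IsLocalizedBasis (μ : Measure X) (Γ : Set X) (S : Submodule ℂ (Lp ℂ 2 μ))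
    (w : Γ → Lp ℂ 2 μ) : Prop where
  orthonormal : Orthonormal ℂ w
  dense_span : (Submodule.span ℂ (Set.range w)).topologicalClosure = S
  decay : ∀ m : ℝ, 0 < m → ∃ C : ℝ, 0 < C ∧ ∀ γ : Γ, ∀ᵐ x ∂μ,
    ‖w γ x‖ ≤ C * (1 + dist x (γ : X)) ^ (-m)

end Wannier

end

noncomputable section

namespace KTheory

section Functoriality

variable {A B : Type*} [NonUnitalRing A] [StarRing A] [Module ℂ A] [IsScalarTower ℂ A A]
  [SMulCommClass ℂ A A] [StarModule ℂ A] [NonUnitalRing B] [StarRing B] [Module ℂ B]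
  [IsScalarTower ℂ B B] [SMulCommClass ℂ B B] [StarModule ℂ B]

theorem K0.mk_eq_zero_iff {p : A} {hp : IsStarProjection p} :
    K0.mk p hp = 0 ↔ Algebra.GrothendieckAddGroup.of (M := VMonoid (Unitization ℂ A))
      (Quotient.mk _ (projMat p hp)) = 0 := by
  rw [Subtype.ext_iff]; rfl

theorem K0Unital.map_of {R S : Type*} [Ring R] [StarRing R] [Ring S] [StarRing S] [Algebra ℂ R]
    [Algebra ℂ S] (φ : R →⋆ₐ[ℂ] S) (x : VMonoid R) :
    K0Unital.map φ (Algebra.GrothendieckAddGroup.of x) =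
      Algebra.GrothendieckAddGroup.of (VMonoid.map φ x) :=
  DFunLike.congr_fun (Algebra.GrothendieckAddGroup.lift.symm_apply_apply
    (Algebra.GrothendieckAddGroup.of.comp (VMonoid.map φ))) x

/-- A `⋆`-homomorphism maps projections with trivial class to projections with trivial class. -/
theorem K0.mk_map_eq_zero (φ : A →⋆ₙₐ[ℂ] B) {p : A} {hp : IsStarProjection p}
    (h : K0.mk p hp = 0) (hp' : IsStarProjection (φ p)) : K0.mk (φ p) hp' = 0 := by
  rw [K0.mk_eq_zero_iff] at h ⊢
  have h₂ := congrArg (K0Unital.map (Unitization.starMap φ)) h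
  rw [map_zero] at h₂
  rw [← h₂]
  refine Eq.trans ?_ (K0Unital.map_of (Unitization.starMap φ) _).symm
  congr 1
  refine Quotient.sound (MatProj.equiv_of_submatrix (Equiv.refl Unit) ?_)
  refine Matrix.ext fun i j => ?_
  exact (Unitization.starMap_inr φ p).symm

/-- Murray--von Neumann equivalence inside of the algebra preserves triviality of the class. -/
theorem K0.mk_eq_zero_of_mul_star {p q : A} {hp : IsStarProjection p} {hq : IsStarProjection q}
    (t : A) (h₁ : t * star t = p) (h₂ : star t * t = q) (h : K0.mk q hq = 0) :
    K0.mk p hp = 0 := by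
  rw [K0.mk_eq_zero_iff] at h ⊢
  rw [← h]
  congr 1
  let T : Matrix Unit Unit (Unitization ℂ A) := Matrix.of fun _ _ => (t : Unitization ℂ A)
  refine Quotient.sound ⟨T, ?_, ?_⟩
  · refine Matrix.ext fun i j => ?_
    change (T * Tᴴ) () () = (p : Unitization ℂ A)
    simp [T, Matrix.mul_apply, ← h₁]
  · refine Matrix.ext fun i j => ?_
    change (Tᴴ * T) () () = (q : Unitization ℂ A)
    simp [T, Matrix.mul_apply, ← h₂]

/-- The sum of two orthogonal projections with trivial classes has trivial class. -/
theorem K0.mk_add_eq_zero {p q s : A} {hp : IsStarProjection p} {hq : IsStarProjection q}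
    {hs : IsStarProjection s} (hpq : p * q = 0) (hadd : p + q = s) (h₁ : K0.mk p hp = 0)
    (h₂ : K0.mk q hq = 0) : K0.mk s hs = 0 := by
  rw [K0.mk_eq_zero_iff] at h₁ h₂ ⊢
  have hqp : q * p = 0 := by
    have := congrArg star hpq
    rwa [star_mul, hp.isSelfAdjoint.star_eq, hq.isSelfAdjoint.star_eq, star_zero] at this
  let T : Matrix Unit (Unit ⊕ Unit) (Unitization ℂ A) :=
    Matrix.of fun _ j => Sum.elim (fun _ => (p : Unitization ℂ A)) (fun _ => q) j
  have h : (Quotient.mk _ (projMat s hs) : VMonoid (Unitization ℂ A)) =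
      (show VMonoid (Unitization ℂ A) from Quotient.mk _ (projMat p hp)) +
        (show VMonoid (Unitization ℂ A) from Quotient.mk _ (projMat q hq)) := by
    refine Quotient.sound ⟨T, ?_, ?_⟩
    · refine Matrix.ext fun i j => ?_
      change (T * Tᴴ) () () = (s : Unitization ℂ A)
      simp [T, Matrix.mul_apply, ← Unitization.inr_star, ← Unitization.inr_mul,
        hp.isSelfAdjoint.star_eq, hq.isSelfAdjoint.star_eq, hp.isIdempotentElem.eq,
        hq.isIdempotentElem.eq, ← hadd]
    · change Tᴴ * T = fromBlocks (projMat p hp).mat 0 0 (projMat q hq).mat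
      refine Matrix.ext fun i j => ?_
      rcases i with i | i <;> rcases j with j | j <;>
      simp [T, Matrix.mul_apply, projMat, ← Unitization.inr_star, ← Unitization.inr_mul,
        hp.isSelfAdjoint.star_eq, hq.isSelfAdjoint.star_eq, hp.isIdempotentElem.eq,
        hq.isIdempotentElem.eq, hpq, hqp] <;> rfl
  rw [h, map_add, h₁, h₂, add_zero]

theorem K0.mk_zero_eq_zero {p : A} {hp : IsStarProjection p} (h : p = 0) : K0.mk p hp = 0 := by
  rw [K0.mk_eq_zero_iff, ← map_zero Algebra.GrothendieckAddGroup.of]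
  congr 1
  refine Quotient.sound ⟨(0 : Matrix Unit Empty _), ?_, Matrix.ext fun i => i.elim⟩
  refine Matrix.ext fun i j => ?_
  change ((0 : Matrix Unit Empty (Unitization ℂ A)) *
    (0 : Matrix Unit Empty (Unitization ℂ A))ᴴ : Matrix Unit Unit (Unitization ℂ A)) () () =
    (p : Unitization ℂ A)
  simp [h]

end Functoriality

section Compact

variable {H : Type*} [NormedAddCommGroup H] [InnerProductSpace ℂ H]

/-- The action of a matrix of operators on a power of the space. -/
def matrixAct {ι : Type*} [Fintype ι] (M : Matrix ι ι (H →L[ℂ] H)) : (ι → H) →L[ℂ] (ι → H) :=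
  ContinuousLinearMap.pi fun i => ∑ j, (M i j).comp (ContinuousLinearMap.proj j)

theorem matrixAct_apply {ι : Type*} [Fintype ι] (M : Matrix ι ι (H →L[ℂ] H)) (x : ι → H) (i : ι) :
    matrixAct M x i = ∑ j, M i j (x j) := by
  simp [matrixAct]

theorem matrixAct_mul {ι : Type*} [Fintype ι] (M N : Matrix ι ι (H →L[ℂ] H)) :
    matrixAct (M * N) = matrixAct M * matrixAct N := by
  ext x i
  simp only [matrixAct_apply, Matrix.mul_apply, mul_apply_eq_comp, _root_.sum_apply, map_sum]
  exact Finset.sum_comm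

theorem matrixAct_injective {ι : Type*} [Fintype ι] [DecidableEq ι] :
    Function.Injective (matrixAct (H := H) (ι := ι)) := by
  intro M N h
  ext i j x
  have := congrFun (DFunLike.congr_fun h (Pi.single j x)) i
  simpa [matrixAct_apply, Pi.single_apply, apply_ite] using this

theorem matrixAct_one {ι : Type*} [Fintype ι] [DecidableEq ι] :
    matrixAct (1 : Matrix ι ι (H →L[ℂ] H)) = 1 := by
  ext x i
  have : ∀ j, (if i = j then (1 : H →L[ℂ] H) else 0) (x j) = if i = j then x j else 0 := by
    intro j; split_ifs <;> simp
  simp [matrixAct_apply, Matrix.one_apply, this]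

theorem matrixAct_sub {ι : Type*} [Fintype ι] (M N : Matrix ι ι (H →L[ℂ] H)) :
    matrixAct (M - N) = matrixAct M - matrixAct N := by
  ext x i
  simp [matrixAct_apply, Finset.sum_sub_distrib]

theorem isCompactOperator_matrixAct {ι : Type*} [Fintype ι] {M : Matrix ι ι (H →L[ℂ] H)}
    (hM : ∀ i j, IsCompactOperator (M i j)) : IsCompactOperator (matrixAct M) := by
  classical
  have : (matrixAct M : (ι → H) →L[ℂ] (ι → H)) = ∑ i, ∑ j,
      (ContinuousLinearMap.single ℂ (fun _ : ι => H) i).comp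
        ((M i j).comp (ContinuousLinearMap.proj j)) := by
    ext x i
    simp [matrixAct_apply, Finset.sum_apply, Pi.single_apply, Finset.sum_ite_irrel]
  have h : matrixAct M ∈ compactOperator (RingHom.id ℂ) (ι → H) (ι → H) := by
    rw [this]
    exact Submodule.sum_mem _ fun i _ => Submodule.sum_mem _ fun j _ =>
      ((hM i j).comp_clm
        (ContinuousLinearMap.proj (R := ℂ) (φ := fun _ : ι => H) j)).clm_comp
        (ContinuousLinearMap.single ℂ (fun _ : ι => H) i)
  exact h

/-- If `M N = 1` for matrices of operators and `N - 1` is compact, then `N M = 1`. -/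
theorem mul_eq_one_of_compact [CompleteSpace H] {ι : Type*} [Fintype ι] [DecidableEq ι]
    {M N : Matrix ι ι (H →L[ℂ] H)} (h : M * N = 1)
    (hN : ∀ i j, IsCompactOperator ((1 - N) i j)) : N * M = 1 := by
  have hc : IsCompactOperator (matrixAct (1 - N)) := isCompactOperator_matrixAct hN
  have hact : matrixAct M * matrixAct N = 1 := by rw [← matrixAct_mul, h, matrixAct_one]
  have hN1 : matrixAct N = 1 - matrixAct (1 - N) := by
    rw [matrixAct_sub, matrixAct_one, sub_sub_cancel]
  have hunit : IsUnit (matrixAct N) := by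
    rcases hc.hasEigenvalue_or_mem_resolventSet (μ := (1 : ℂ)) one_ne_zero with he | hr
    · obtain ⟨x, hx⟩ := he.exists_hasEigenvector
      refine absurd ?_ hx.2
      have h1 : matrixAct (1 - N) x = x := by simpa using hx.apply_eq_smul
      have h2 : matrixAct N x = 0 := by rw [hN1]; simp [h1]
      have := DFunLike.congr_fun hact x
      simpa [h2] using this.symm
    · rw [spectrum.mem_resolventSet_iff, map_one, ← hN1] at hr
      exact hr
  apply matrixAct_injective
  rw [matrixAct_mul, matrixAct_one]
  obtain ⟨u, hu⟩ := hunit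
  rw [← hu] at hact ⊢
  rw [← Units.inv_eq_of_mul_eq_one_left hact, Units.mul_inv]

variable [CompleteSpace H] {A : NonUnitalStarSubalgebra ℂ (H →L[ℂ] H)}

/-- The action of the unitization of an algebra of operators. -/
def unitizationAct (A : NonUnitalStarSubalgebra ℂ (H →L[ℂ] H)) :
    Unitization ℂ A →ₐ[ℂ] (H →L[ℂ] H) :=
  Unitization.lift (NonUnitalStarSubalgebraClass.subtype A : A →ₙₐ[ℂ] (H →L[ℂ] H))

theorem unitizationAct_apply (x : Unitization ℂ A) :
    unitizationAct A x = algebraMap ℂ _ x.fst + (x.snd : H →L[ℂ] H) := rfl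

/-- Matrix algebras over the unitization of an algebra of compact operators are finite. -/
theorem act_mul_eq_one_of_mul_eq_one (hA : ∀ a ∈ A, IsCompactOperator a) {ι : Type*} [Fintype ι]
    [DecidableEq ι] {B C : Matrix ι ι (Unitization ℂ A)} (h : B * C = 1) :
    (unitizationAct A).toRingHom.mapMatrix (C * B) = 1 := by
  let act := (unitizationAct A).toRingHom.mapMatrix (m := ι)
  let scal := (algebraMap ℂ (H →L[ℂ] H)).mapMatrix (m := ι)
  let aug := (Unitization.fstHom ℂ A).toRingHom.mapMatrix (m := ι)
  have h0 : aug B * aug C = 1 := by rw [← map_mul, h, map_one]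
  have h0' : aug C * aug B = 1 := mul_eq_one_comm.1 h0
  have hMN : (scal (aug C) * act B) * (act C * scal (aug B)) = 1 := by
    rw [mul_assoc, ← mul_assoc (act B), ← map_mul act, h, map_one, one_mul, ← map_mul, h0', map_one]
  have hNM := mul_eq_one_of_compact hMN ?_
  · rwa [mul_assoc, ← mul_assoc (scal _), ← map_mul scal, h0, map_one, one_mul, ← map_mul] at hNM
  · intro i j
    have : 1 - act C * scal (aug B) = (scal (aug C) - act C) * scal (aug B) := by
      rw [sub_mul, ← map_mul scal, h0', map_one]
    rw [this, Matrix.mul_apply]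
    have hmem : ∑ k, (scal (aug C) - act C) i k * scal (aug B) k j ∈
        compactOperator (RingHom.id ℂ) H H := by
      refine Submodule.sum_mem _ fun k _ => ?_
      have : (scal (aug C) - act C) i k = -((C i k).snd : H →L[ℂ] H) := by
        change algebraMap ℂ _ (C i k).fst - unitizationAct A (C i k) = _
        rw [unitizationAct_apply]; abel
      rw [this]
      exact (hA _ (C i k).snd.2).neg.comp_clm _
    exact hmem

/-- The partial isometry in a Murray--von Neumann equivalence can be chosen with the correct
initial and final spaces. -/
theorem MvN.exists_absorbing {R : Type*} [Ring R] [StarRing R] {p q : MatProj R} (h : MvN p q) :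
    ∃ v : Matrix p.ι q.ι R, v * vᴴ = p.mat ∧ vᴴ * v = q.mat ∧ p.mat * v = v ∧ v * q.mat = v := by
  obtain ⟨v, h₁, h₂⟩ := h
  have h₃ : (p.mat * v)ᴴ = vᴴ * p.mat := by rw [conjTranspose_mul, p.selfAdj]
  refine ⟨p.mat * v, ?_, ?_, ?_, ?_⟩
  · rw [h₃, Matrix.mul_assoc, ← Matrix.mul_assoc v, h₁, p.idem, p.idem]
  · rw [h₃, Matrix.mul_assoc, ← Matrix.mul_assoc p.mat, p.idem, ← h₁, Matrix.mul_assoc, h₂,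
      ← Matrix.mul_assoc, h₂, q.idem]
  · rw [← Matrix.mul_assoc, p.idem]
  · rw [← h₁, ← h₂, Matrix.mul_assoc, Matrix.mul_assoc, ← Matrix.mul_assoc vᴴ v, h₂, q.idem,
      ← h₂, ← Matrix.mul_assoc]

theorem mul_eq_of_fromRows {S : Type*} [Ring S] [StarRing S] {ι : Type*} [Fintype ι]
    [DecidableEq ι] {R b : Matrix ι ι S} {a : Matrix Unit ι S} (hR : Rᴴ = R) (hRR : R * R = R)
    (hbb : b * bᴴ = R) (h₂ : bᴴ * b + aᴴ * a = R) (hRb : R * b = b) (hbR : b * R = b) :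
    (b + (1 - R)) * (bᴴ + (1 - R)) = 1 ∧ (bᴴ + (1 - R)) * (b + (1 - R)) = 1 - aᴴ * a := by
  have hRb' : R * bᴴ = bᴴ := by
    nth_rw 1 [← hR]
    rw [← conjTranspose_mul, hbR]
  have hbR' : bᴴ * R = bᴴ := by
    nth_rw 1 [← hR]
    rw [← conjTranspose_mul, hRb]
  constructor
  · rw [Matrix.add_mul, Matrix.mul_add, Matrix.mul_add, Matrix.sub_mul, Matrix.mul_sub,
      Matrix.mul_sub, Matrix.sub_mul, Matrix.sub_mul 1 R R, Matrix.mul_one R, hbb,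
      hbR, hRb', hRR, Matrix.mul_one, Matrix.mul_one, Matrix.one_mul, Matrix.one_mul]
    abel
  · rw [Matrix.add_mul, Matrix.mul_add, Matrix.mul_add, Matrix.sub_mul, Matrix.mul_sub,
      Matrix.mul_sub, Matrix.sub_mul, Matrix.sub_mul 1 R R, Matrix.mul_one R,
      eq_sub_of_add_eq h₂, hbR', hRb, hRR, Matrix.mul_one, Matrix.mul_one, Matrix.one_mul, Matrix.one_mul]
    abel

theorem eq_zero_of_fromRows (hA : ∀ a ∈ A, IsCompactOperator a) {q : A} {ι : Type*} [Fintype ι]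
    {R : Matrix ι ι (Unitization ℂ A)} (hR : Rᴴ = R) (hRR : R * R = R)
    {Q : Matrix Unit Unit (Unitization ℂ A)} (hQ : Q () () = q) (hQQ : Q * Q = Q)
    {v : Matrix (ι ⊕ Unit) ι (Unitization ℂ A)} (h₁ : v * vᴴ = fromBlocks R 0 0 Q)
    (h₂ : vᴴ * v = R) (h₃ : fromBlocks R 0 0 Q * v = v) (h₄ : v * R = v) : q = 0 := by
  classical
  obtain ⟨b, a, rfl⟩ : ∃ b a, v = fromRows b a := ⟨_, _, (fromRows_toRows v).symm⟩
  rw [conjTranspose_fromRows_eq_fromCols_conjTranspose, fromRows_mul_fromCols,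
    fromBlocks_inj] at h₁
  rw [conjTranspose_fromRows_eq_fromCols_conjTranspose, fromCols_mul_fromRows] at h₂
  rw [fromRows_mul, fromRows_ext_iff] at h₄
  rw [fromBlocks_mul_fromRows, fromRows_ext_iff] at h₃
  obtain ⟨hbb, -, -, haa⟩ := h₁
  have hRb : R * b = b := by
    have := h₃.1
    rwa [Matrix.zero_mul, add_zero] at this
  obtain ⟨hBC, hCB⟩ := mul_eq_of_fromRows hR hRR hbb h₂ hRb h₄.1
  have hact := act_mul_eq_one_of_mul_eq_one hA hBC
  rw [hCB, map_sub, map_one, sub_eq_self] at hact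
  have hzero : (aᴴ * a).map (unitizationAct A) = 0 := hact
  have hQa : Q = a * (aᴴ * a) * aᴴ := by
    rw [← hQQ, ← haa]; simp only [Matrix.mul_assoc]
  have hmap : Q.map (unitizationAct A) = 0 := by
    rw [hQa, Matrix.map_mul, Matrix.map_mul, hzero, Matrix.mul_zero, Matrix.zero_mul]
  have h0 : unitizationAct A (q : Unitization ℂ A) = 0 := by
    rw [← hQ]
    exact congrFun (congrFun hmap ()) ()
  rw [unitizationAct_apply] at h0
  simpa using h0

/-- In an algebra of compact operators only the zero projection has trivial class. -/
theorem eq_zero_of_K0_mk_eq_zero (hA : ∀ a ∈ A, IsCompactOperator a) {q : A}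
    {hq : IsStarProjection q} (h : K0.mk q hq = 0) : q = 0 := by
  rw [K0.mk_eq_zero_iff, ← map_zero Algebra.GrothendieckAddGroup.of] at h
  obtain ⟨⟨c, hc0⟩, hc⟩ := (AddLocalization.addMonoidOf ⊤).eq_iff_exists.1 h
  induction c using Quotient.inductionOn with | _ r
  rw [add_zero] at hc
  have hc' : (Quotient.mk _ (r.add (projMat q hq)) : VMonoid _) = Quotient.mk _ r := hc
  obtain ⟨v, h₁, h₂, h₃, h₄⟩ := MvN.exists_absorbing (Quotient.exact hc')
  exact eq_zero_of_fromRows hA r.selfAdj r.idem (Q := (projMat q hq).mat) rfl (projMat q hq).idem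
    h₁ h₂ h₃ h₄

end Compact

end KTheory

/-! ## Synthesis operators -/

section Synthesis

open scoped InnerProductSpace

variable {ι H : Type*} [NormedAddCommGroup H] [InnerProductSpace ℂ H]

/-- A family of vectors is Bessel with bound `M` if its synthesis operator has norm at most `M`. -/
def IsBessel (M : ℝ) (u : ι → H) : Prop :=
  ∀ (F : Finset ι) (c : ι → ℂ), ‖∑ i ∈ F, c i • u i‖ ≤ M * √(∑ i ∈ F, ‖c i‖ ^ 2)

/-- `S` is the synthesis operator of the family `u`: it maps the standard basis to `u`. -/
def IsSynthesis [DecidableEq ι] (S : lp (fun _ : ι => ℂ) 2 →L[ℂ] H) (u : ι → H) : Prop :=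
  ∀ i, S (lp.single 2 i 1) = u i

theorem lp_two_sqrt_sum_le {G : ι → Type*} [∀ i, NormedAddCommGroup (G i)]
    (c : lp G 2) (F : Finset ι) : √(∑ i ∈ F, ‖c i‖ ^ 2) ≤ ‖c‖ := by
  refine Real.sqrt_le_iff.2 ⟨norm_nonneg _, ?_⟩
  have := lp.sum_rpow_le_norm_rpow (p := 2) (by norm_num) c F
  simpa using this

theorem lp_two_summable_sq {G : ι → Type*} [∀ i, NormedAddCommGroup (G i)] (c : lp G 2) :
    Summable fun i => ‖c i‖ ^ 2 := by
  have := (lp.memℓp c).summable (p := 2) (by norm_num)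
  simpa using this

namespace IsSynthesis

variable [DecidableEq ι] {S S' : lp (fun _ : ι => ℂ) 2 →L[ℂ] H} {u u' : ι → H}

theorem hasSum (hS : IsSynthesis S u) (c : lp (fun _ : ι => ℂ) 2) :
    HasSum (fun i => c i • u i) (S c) := by
  have := (lp.hasSum_single (p := 2) (by norm_num) c).mapL S
  convert this using 2 with i
  rw [← hS i, ← map_smul, ← lp.single_smul, smul_eq_mul, mul_one]

theorem sub (hS : IsSynthesis S u) (hS' : IsSynthesis S' u') :
    IsSynthesis (S - S') (fun i => u i - u' i) := fun i => by
  simp [hS i, hS' i]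

theorem comp {K : Type*} [NormedAddCommGroup K] [InnerProductSpace ℂ K] (hS : IsSynthesis S u)
    (T : H →L[ℂ] K) : IsSynthesis (T ∘L S) (fun i => T (u i)) := fun i => by
  simp [hS i]

theorem ext (hS : IsSynthesis S u) (hS' : IsSynthesis S' u) : S = S' := by
  ext c
  exact (hS.hasSum c).unique (hS'.hasSum c)

theorem norm_le (hS : IsSynthesis S u) {M : ℝ} (hM : 0 ≤ M) (hu : IsBessel M u) : ‖S‖ ≤ M := by
  refine S.opNorm_le_bound hM fun c => ?_
  refine le_of_tendsto (hS.hasSum c).norm (Filter.Eventually.of_forall fun F => ?_)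
  exact (hu F _).trans (mul_le_mul_of_nonneg_left (lp_two_sqrt_sum_le c F) hM)

theorem adjoint_apply [CompleteSpace H] (hS : IsSynthesis S u) (h : H) (i : ι) :
    (ContinuousLinearMap.adjoint S h) i = ⟪u i, h⟫_ℂ := by
  rw [← hS i, ← ContinuousLinearMap.adjoint_inner_right, lp.inner_single_left]
  simp

end IsSynthesis

theorem IsBessel.exists_isSynthesis [CompleteSpace H] [DecidableEq ι] {u : ι → H} {M : ℝ}
    (hM : 0 ≤ M) (hu : IsBessel M u) :
    ∃ S : lp (fun _ : ι => ℂ) 2 →L[ℂ] H, IsSynthesis S u := by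
  have hsum : ∀ c : lp (fun _ : ι => ℂ) 2, Summable fun i => c i • u i := fun c => by
    rw [summable_iff_vanishing_norm]
    intro ε hε
    obtain ⟨s, hs⟩ := summable_iff_vanishing_norm.1 (lp_two_summable_sq c)
      ((ε / (M + 1)) ^ 2) (by positivity)
    refine ⟨s, fun t ht => (hu t _).trans_lt ?_⟩
    have h1 := (le_abs_self _).trans_lt (hs t ht)
    have h2 : √(∑ i ∈ t, ‖c i‖ ^ 2) < ε / (M + 1) := (Real.sqrt_lt' (by positivity)).2 h1
    calc M * √(∑ i ∈ t, ‖c i‖ ^ 2) ≤ (M + 1) * √(∑ i ∈ t, ‖c i‖ ^ 2) := by gcongr; linarith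
      _ < (M + 1) * (ε / (M + 1)) := by gcongr
      _ = ε := by field_simp
  let L : lp (fun _ : ι => ℂ) 2 →ₗ[ℂ] H :=
    { toFun := fun c => ∑' i, c i • u i
      map_add' := fun c c' => by
        rw [← (hsum c).tsum_add (hsum c')]
        simp [add_smul]
      map_smul' := fun a c => by
        rw [RingHom.id_apply, ← (hsum c).tsum_const_smul]
        simp [mul_smul] }
  refine ⟨L.mkContinuous M fun c => ?_, fun i => ?_⟩
  · refine le_of_tendsto (hsum c).hasSum.norm (Filter.Eventually.of_forall fun F => ?_)
    exact (hu F _).trans (mul_le_mul_of_nonneg_left (lp_two_sqrt_sum_le c F) hM)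
  · change ∑' j, (lp.single 2 i (1 : ℂ) : lp (fun _ : ι => ℂ) 2) j • u j = u i
    rw [tsum_eq_single i fun j hj => by rw [lp.single_apply_ne _ _ _ hj, zero_smul],
      lp.single_apply_self, one_smul]

/-- The synthesis operator of an orthonormal family is an isometry. -/
theorem Orthonormal.exists_isSynthesis [CompleteSpace H] [DecidableEq ι] {u : ι → H}
    (hu : Orthonormal ℂ u) :
    ∃ S : lp (fun _ : ι => ℂ) 2 →L[ℂ] H, IsSynthesis S u ∧
      ContinuousLinearMap.adjoint S ∘L S = 1 := by
  refine ⟨(OrthogonalFamily.linearIsometry hu.orthogonalFamily).toContinuousLinearMap,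
    fun i => ?_, LinearIsometry.adjoint_comp_self _⟩
  simp [OrthogonalFamily.linearIsometry_apply_single]

end Synthesis

/-! ## Locality of operators on modules -/

namespace Roe

open scoped InnerProductSpace
open ContinuousLinearMap (adjoint)

section Module

variable {Y : Type*} [MetricSpace Y] {𝓗 : Type*} [NormedAddCommGroup 𝓗] [InnerProductSpace ℂ 𝓗]
  [CompleteSpace 𝓗] {ρ : C₀(Y, ℂ) →⋆ₙₐ[ℂ] (𝓗 →L[ℂ] 𝓗)}

theorem mem_algebra {T : 𝓗 →L[ℂ] 𝓗} (h : IsLocallyCompact ρ T) (h' : HasFinitePropagation ρ T) :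
    T ∈ algebra ρ :=
  NonUnitalStarSubalgebra.le_topologicalClosure _
    (NonUnitalStarAlgebra.subset_adjoin ℂ _ ⟨h, h'⟩)

theorem isClosed_algebra : IsClosed (algebra ρ : Set (𝓗 →L[ℂ] 𝓗)) :=
  NonUnitalStarSubalgebra.isClosed_topologicalClosure _

/-- A closed `⋆`-subalgebra which contains all locally compact operators of finite propagation
contains the Roe algebra. -/
theorem algebra_le {B : NonUnitalStarSubalgebra ℂ (𝓗 →L[ℂ] 𝓗)}
    (hB : IsClosed (B : Set (𝓗 →L[ℂ] 𝓗)))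
    (h : ∀ T, IsLocallyCompact ρ T → HasFinitePropagation ρ T → T ∈ B) : algebra ρ ≤ B :=
  NonUnitalStarSubalgebra.topologicalClosure_minimal _
    (NonUnitalStarAlgebra.adjoin_le fun T hT => h T hT.1 hT.2) hB

theorem inner_rep (f : C₀(Y, ℂ)) (x y : 𝓗) : ⟪ρ f x, y⟫_ℂ = ⟪x, ρ (star f) y⟫_ℂ := by
  rw [map_star, ContinuousLinearMap.star_eq_adjoint, ContinuousLinearMap.adjoint_inner_right]

theorem tsupport_star (f : C₀(Y, ℂ)) : tsupport ⇑(star f) = tsupport f := by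
  refine congrArg closure (Set.ext fun x => ?_)
  simp

/-- A vector is supported in `B` if it is annihilated by the functions supported away from `B`. -/
def SupportedIn (ρ : C₀(Y, ℂ) →⋆ₙₐ[ℂ] (𝓗 →L[ℂ] 𝓗)) (h : 𝓗) (B : Set Y) : Prop :=
  ∀ f : C₀(Y, ℂ), Disjoint (tsupport f) B → ρ f h = 0

theorem isCompactOperator_rankOne {E F : Type*} [NormedAddCommGroup E] [InnerProductSpace ℂ E]
    [NormedAddCommGroup F] [InnerProductSpace ℂ F] (x : E) (y : F) :
    IsCompactOperator ((innerSL ℂ x).smulRight y : E →L[ℂ] F) := by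
  have : IsCompactOperator (innerSL ℂ x : E → ℂ) :=
    isCompactOperator_of_locallyCompactSpace_dom (innerSL ℂ x)
  exact this.clm_comp (ContinuousLinearMap.toSpanSingleton ℂ y)

theorem isCompactOperator_sum {E F κ : Type*} [NormedAddCommGroup E] [InnerProductSpace ℂ E]
    [NormedAddCommGroup F] [InnerProductSpace ℂ F] (s : Finset κ) (T : κ → E →L[ℂ] F)
    (h : ∀ i ∈ s, IsCompactOperator (T i)) : IsCompactOperator (∑ i ∈ s, T i : E →L[ℂ] F) :=
  Submodule.sum_mem (compactOperator (RingHom.id ℂ) E F) h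

variable {ι : Type*} [DecidableEq ι]

/-- The operator `∑ᵢ |uᵢ⟩⟨eᵢ|` for locally finite families `u` and `e` with uniformly bounded
supports is locally compact and of finite propagation. -/
theorem synthesis_local {S S' : lp (fun _ : ι => ℂ) 2 →L[ℂ] 𝓗} {u e : ι → 𝓗}
    (hS : IsSynthesis S u) (hS' : IsSynthesis S' e) {x : ι → Y} {R : ℝ} (hR : 0 < R)
    (hu : ∀ i, SupportedIn ρ (u i) (Metric.ball (x i) R))
    (he : ∀ i, SupportedIn ρ (e i) (Metric.ball (x i) R))
    (hfin : ∀ K : Set Y, IsCompact K → {i | ¬ Disjoint K (Metric.ball (x i) R)}.Finite) :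
    IsLocallyCompact ρ (S ∘L adjoint S') ∧ HasFinitePropagation ρ (S ∘L adjoint S') := by
  have hsum : ∀ h, HasSum (fun i => ⟪e i, h⟫_ℂ • u i) (S (adjoint S' h)) := fun h => by
    simpa only [hS'.adjoint_apply] using hS.hasSum (adjoint S' h)
  constructor
  · intro f hf
    set F := (hfin _ hf).toFinset with hF
    have hmem : ∀ i, i ∉ F → Disjoint (tsupport f) (Metric.ball (x i) R) := fun i hi => by
      by_contra h
      exact hi (by simpa [hF] using h)
    constructor
    · have : (S ∘L adjoint S') * ρ f = ∑ i ∈ F, (innerSL ℂ (ρ (star f) (e i))).smulRight (u i) := by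
        ext h
        refine (hsum (ρ f h)).unique ?_
        have h0 : ∀ i, ⟪e i, ρ f h⟫_ℂ = ⟪ρ (star f) (e i), h⟫_ℂ := fun i => by
          rw [inner_rep, star_star]
        simp only [h0]
        rw [_root_.sum_apply]
        refine hasSum_sum_of_ne_finset_zero fun i hi => ?_
        rw [he i (star f) (by rw [tsupport_star]; exact hmem i hi), inner_zero_left, zero_smul]
      rw [this]
      exact isCompactOperator_sum _ _ fun i _ => isCompactOperator_rankOne _ _
    · have : ρ f * (S ∘L adjoint S') = ∑ i ∈ F, (innerSL ℂ (e i)).smulRight (ρ f (u i)) := by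
        ext h
        refine ((hsum h).mapL (ρ f)).unique ?_
        simp only [map_smul]
        rw [_root_.sum_apply]
        refine hasSum_sum_of_ne_finset_zero fun i hi => ?_
        rw [hu i f (hmem i hi), smul_zero]
      rw [this]
      exact isCompactOperator_sum _ _ fun i _ => isCompactOperator_rankOne _ _
  · refine ⟨2 * R, by positivity, fun f g hfg => ?_⟩
    ext h
    refine ((hsum (ρ g h)).mapL (ρ f)).unique ?_
    have h0 : ∀ i, ρ f (⟪e i, ρ g h⟫_ℂ • u i) = 0 := ?_
    · simp only [h0]
      exact hasSum_zero
    intro i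
    rw [map_smul]
    by_cases hf : Disjoint (tsupport f) (Metric.ball (x i) R)
    · rw [hu i f hf, smul_zero]
    · obtain ⟨y, hy, hyi⟩ := Set.not_disjoint_iff.1 hf
      have hg : Disjoint (tsupport g) (Metric.ball (x i) R) := by
        refine Set.disjoint_left.2 fun z hz hzi => ?_
        have h1 := hfg y hy z hz
        have h2 := dist_triangle_right y z (x i)
        rw [Metric.mem_ball] at hyi hzi
        linarith
      rw [← star_star g, ← inner_rep, he i (star g) (by rwa [tsupport_star]), inner_zero_left,
        zero_smul]

end Module

section Covering

variable {X Y : Type*} [MetricSpace X] [MetricSpace Y] {𝓗 𝓚 : Type*}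
  [NormedAddCommGroup 𝓗] [InnerProductSpace ℂ 𝓗] [CompleteSpace 𝓗]
  [NormedAddCommGroup 𝓚] [InnerProductSpace ℂ 𝓚] [CompleteSpace 𝓚]

/-- An operator `V = ∑ⱼ Uⱼ ρ(ψⱼ)` between modules which covers the map `i : Y → X` up to the
distance `D`: the ranges of the `Uⱼ` are supported in sets `Bⱼ` which are locally finite and
within distance `D` of the compact supports of the real functions `ψⱼ`. -/
structure Covers (ρ : C₀(Y, ℂ) →⋆ₙₐ[ℂ] (𝓗 →L[ℂ] 𝓗)) (σ : C₀(X, ℂ) →⋆ₙₐ[ℂ] (𝓚 →L[ℂ] 𝓚))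
    (i : Y → X) (D : ℝ) {J : Type*} (U : J → 𝓗 →L[ℂ] 𝓚) (ψ : J → C₀(Y, ℂ)) (B : J → Set X)
    (V : 𝓗 →L[ℂ] 𝓚) : Prop where
  isometry : adjoint V ∘L V = 1
  hasSum : ∀ h, HasSum (fun j => U j (ρ (ψ j) h)) (V h)
  supported : ∀ j h, SupportedIn σ (U j h) (B j)
  compact_support : ∀ j, HasCompactSupport (ψ j)
  star_eq : ∀ j, star (ψ j) = ψ j
  dist_le : ∀ j, ∀ y ∈ tsupport (ψ j), ∀ b ∈ B j, dist b (i y) ≤ D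
  finite : ∀ K : Set X, IsCompact K → {j | ¬ Disjoint K (B j)}.Finite

namespace Covers

variable {ρ : C₀(Y, ℂ) →⋆ₙₐ[ℂ] (𝓗 →L[ℂ] 𝓗)} {σ : C₀(X, ℂ) →⋆ₙₐ[ℂ] (𝓚 →L[ℂ] 𝓚)}
  {i : Y → X} {D : ℝ} {J : Type*} {U : J → 𝓗 →L[ℂ] 𝓚} {ψ : J → C₀(Y, ℂ)} {B : J → Set X}
  {V : 𝓗 →L[ℂ] 𝓚}

theorem rep_apply_eq_zero (hV : Covers ρ σ i D U ψ B V) {f : C₀(X, ℂ)} {h : 𝓗}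
    (h0 : ∀ j, ¬ Disjoint (tsupport f) (B j) → ρ (ψ j) h = 0) : σ f (V h) = 0 := by
  refine ((hV.hasSum h).mapL (σ f)).unique ?_
  have h1 : ∀ j, σ f (U j (ρ (ψ j) h)) = 0 := fun j => by
    by_cases hj : Disjoint (tsupport f) (B j)
    · exact hV.supported j _ f hj
    · rw [h0 j hj, map_zero, map_zero]
  simpa only [h1] using hasSum_zero

theorem supportedIn (hV : Covers ρ σ i D U ψ B V) (hi : Isometry i) {e : 𝓗} {y : Y} {r : ℝ}
    (he : SupportedIn ρ e (Metric.ball y r)) :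
    SupportedIn σ (V e) (Metric.ball (i y) (r + D)) := by
  intro f hf
  refine hV.rep_apply_eq_zero fun j hj => he _ ?_
  obtain ⟨b, hbf, hb⟩ := Set.not_disjoint_iff.1 hj
  refine Set.disjoint_left.2 fun z hz hzy => Set.disjoint_left.1 hf hbf ?_
  have h1 := hV.dist_le j z hz b hb
  have h2 := dist_triangle b (i z) (i y)
  rw [hi.dist_eq] at h2
  rw [Metric.mem_ball] at hzy ⊢
  linarith

theorem exists_rep_comp (hV : Covers ρ σ i D U ψ B V) {f : C₀(X, ℂ)} (hf : HasCompactSupport f) :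
    ∃ F : Finset J, σ f ∘L V = ∑ j ∈ F, (σ f ∘L U j) ∘L ρ (ψ j) := by
  refine ⟨(hV.finite _ hf).toFinset, ?_⟩
  ext h
  refine ((hV.hasSum h).mapL (σ f)).unique ?_
  rw [_root_.sum_apply]
  refine hasSum_sum_of_ne_finset_zero fun j hj => hV.supported j _ f ?_
  by_contra hn
  exact hj (by simpa using hn)

theorem adjoint_rep (ρ : C₀(Y, ℂ) →⋆ₙₐ[ℂ] (𝓗 →L[ℂ] 𝓗)) (f : C₀(Y, ℂ)) :
    adjoint (ρ f) = ρ (star f) := by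
  rw [map_star, ContinuousLinearMap.star_eq_adjoint]

theorem isLocallyCompact_conj (hV : Covers ρ σ i D U ψ B V) {T : 𝓗 →L[ℂ] 𝓗}
    (hT : IsLocallyCompact ρ T) : IsLocallyCompact σ (V ∘L T ∘L adjoint V) := by
  intro f hf
  constructor
  · obtain ⟨F, hF⟩ := hV.exists_rep_comp (f := star f)
      (by rw [HasCompactSupport, tsupport_star]; exact hf)
    have h1 : adjoint V ∘L σ f = ∑ j ∈ F, ρ (ψ j) ∘L adjoint (σ (star f) ∘L U j) := by
      have := congrArg adjoint hF
      rw [ContinuousLinearMap.adjoint_comp, adjoint_rep, star_star, map_sum] at this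
      rw [this]
      refine Finset.sum_congr rfl fun j _ => ?_
      rw [ContinuousLinearMap.adjoint_comp, adjoint_rep, hV.star_eq]
    have h2 : (V ∘L T ∘L adjoint V) * σ f =
        ∑ j ∈ F, V ∘L (T * ρ (ψ j)) ∘L adjoint (σ (star f) ∘L U j) := by
      change V ∘L T ∘L (adjoint V ∘L σ f) = _
      rw [h1]
      ext h
      simp
    rw [h2]
    exact isCompactOperator_sum _ _ fun j _ =>
      ((hT _ (hV.compact_support j)).1.comp_clm (adjoint (σ (star f) ∘L U j))).clm_comp V
  · obtain ⟨F, hF⟩ := hV.exists_rep_comp hf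
    have h2 : σ f * (V ∘L T ∘L adjoint V) =
        ∑ j ∈ F, (σ f ∘L U j) ∘L (ρ (ψ j) * T) ∘L adjoint V := by
      change (σ f ∘L V) ∘L T ∘L adjoint V = _
      rw [hF]
      ext h
      simp
    rw [h2]
    exact isCompactOperator_sum _ _ fun j _ =>
      ((hT _ (hV.compact_support j)).2.comp_clm (adjoint V)).clm_comp (σ f ∘L U j)

theorem hasFinitePropagation_conj (hV : Covers ρ σ i D U ψ B V) (hi : Isometry i) (hD : 0 ≤ D)
    {T : 𝓗 →L[ℂ] 𝓗} (hT : HasFinitePropagation ρ T) :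
    HasFinitePropagation σ (V ∘L T ∘L adjoint V) := by
  obtain ⟨R, hR, hT⟩ := hT
  refine ⟨R + 2 * D, by positivity, fun f g hfg => ?_⟩
  ext h
  refine hV.rep_apply_eq_zero (f := f) (h := T (adjoint V (σ g h))) fun j hj => ?_
  refine ext_inner_left ℂ fun k => ?_
  rw [inner_zero_right, ← hV.star_eq, ← inner_rep, ← ContinuousLinearMap.adjoint_inner_left,
    ContinuousLinearMap.adjoint_inner_right, ← star_star g, ← inner_rep]
  rw [hV.rep_apply_eq_zero, inner_zero_left]
  intro l hl
  rw [tsupport_star] at hl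
  obtain ⟨b, hbf, hb⟩ := Set.not_disjoint_iff.1 hj
  obtain ⟨c, hcg, hc⟩ := Set.not_disjoint_iff.1 hl
  have h0 := hT (ψ j) (ψ l) fun y hy z hz => by
    have h1 := hV.dist_le j y hy b hb
    have h2 := hV.dist_le l z hz c hc
    have h3 := hfg b hbf c hcg
    have h4 := dist_triangle4 b (i y) (i z) c
    rw [hi.dist_eq, dist_comm (i z)] at h4
    linarith
  have h5 := congrArg adjoint h0
  rw [map_zero] at h5
  have h6 := DFunLike.congr_fun h5 k
  change adjoint ((ρ (ψ j) ∘L T) ∘L ρ (ψ l)) k = 0 at h6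
  rw [ContinuousLinearMap.adjoint_comp, ContinuousLinearMap.adjoint_comp, adjoint_rep,
    adjoint_rep, hV.star_eq, hV.star_eq] at h6
  exact h6

end Covers

/-- Conjugation with an isometry. -/
def conjHom (V : 𝓗 →L[ℂ] 𝓚) (hV : adjoint V ∘L V = 1) :
    (𝓗 →L[ℂ] 𝓗) →⋆ₙₐ[ℂ] (𝓚 →L[ℂ] 𝓚) where
  toFun T := V ∘L T ∘L adjoint V
  map_smul' c T := by ext; simp
  map_zero' := by ext; simp
  map_add' S T := by ext; simp
  map_mul' S T := by
    ext h
    have : ∀ k, adjoint V (V k) = k := fun k => DFunLike.congr_fun hV k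
    simp [this]
  map_star' T := by
    simp [ContinuousLinearMap.star_eq_adjoint, ContinuousLinearMap.adjoint_comp,
      ContinuousLinearMap.comp_assoc]

theorem continuous_conjHom (V : 𝓗 →L[ℂ] 𝓚) (hV : adjoint V ∘L V = 1) :
    Continuous (conjHom V hV) := by
  change Continuous fun T : 𝓗 →L[ℂ] 𝓗 => V ∘L T ∘L adjoint V
  fun_prop

/-- A covering isometry induces a homomorphism of Roe algebras. -/
theorem Covers.exists_hom {ρ : C₀(Y, ℂ) →⋆ₙₐ[ℂ] (𝓗 →L[ℂ] 𝓗)}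
    {σ : C₀(X, ℂ) →⋆ₙₐ[ℂ] (𝓚 →L[ℂ] 𝓚)} {i : Y → X} {D : ℝ} {J : Type*}
    {U : J → 𝓗 →L[ℂ] 𝓚} {ψ : J → C₀(Y, ℂ)} {B : J → Set X} {V : 𝓗 →L[ℂ] 𝓚}
    (hV : Covers ρ σ i D U ψ B V) (hi : Isometry i) (hD : 0 ≤ D) :
    ∃ φ : algebra ρ →⋆ₙₐ[ℂ] algebra σ, ∀ T, (φ T : 𝓚 →L[ℂ] 𝓚) = V ∘L T ∘L adjoint V := by
  have hle : algebra ρ ≤ (algebra σ).comap (conjHom V hV.isometry) :=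
    algebra_le (isClosed_algebra.preimage (continuous_conjHom V hV.isometry)) fun T h₁ h₂ =>
      mem_algebra (hV.isLocallyCompact_conj h₁) (hV.hasFinitePropagation_conj hi hD h₂)
  exact ⟨NonUnitalStarAlgHom.codRestrict
    ((conjHom V hV.isometry).comp (NonUnitalStarSubalgebraClass.subtype (algebra ρ)))
    (algebra σ) fun T => hle T.2, fun T => rfl⟩

end Covering

end Roe

/-! ## Existence of covering isometries -/

namespace Roe

open scoped InnerProductSpace Topology
open ContinuousLinearMap (adjoint)

section Partition

variable {Y : Type*} [MetricSpace Y] {𝓗 : Type*} [NormedAddCommGroup 𝓗] [InnerProductSpace ℂ 𝓗]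
  [CompleteSpace 𝓗] {ρ : C₀(Y, ℂ) →⋆ₙₐ[ℂ] (𝓗 →L[ℂ] 𝓗)} {J : Type*}

theorem sum_le_one_of_partition (φ : PartitionOfUnity J Y Set.univ) (F : Finset J) (y : Y) :
    ∑ j ∈ F, φ j y ≤ 1 := by
  classical
  have hfin := φ.locallyFinite.point_finite y
  rw [← φ.sum_eq_one (Set.mem_univ y),
    finsum_eq_sum_of_support_subset (s := F ∪ hfin.toFinset) _ fun j hj => by
      simpa using Or.inr hj]
  exact Finset.sum_le_sum_of_subset_of_nonneg Finset.subset_union_left fun j _ _ => φ.nonneg j y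

theorem exists_finset_sum_eq_one (φ : PartitionOfUnity J Y Set.univ) {K : Set Y}
    (hK : IsCompact K) :
    ∃ F₀ : Finset J, ∀ F, F₀ ⊆ F → ∀ y ∈ K, ∑ j ∈ F, φ j y = 1 := by
  refine ⟨(φ.locallyFinite.finite_nonempty_inter_compact hK).toFinset, fun F hF y hy => ?_⟩
  rw [← φ.sum_eq_one (Set.mem_univ y)]
  refine (finsum_eq_sum_of_support_subset _ fun j hj => hF ?_).symm
  simp only [Set.Finite.mem_toFinset, Set.mem_ofPred_eq]
  exact ⟨y, hj, hy⟩

theorem sum_apply_C0 (F : Finset J) (f : J → C₀(Y, ℂ)) (y : Y) :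
    (∑ j ∈ F, f j) y = ∑ j ∈ F, f j y := by
  classical
  induction F using Finset.induction_on with
  | empty => simp
  | insert a s ha ih => rw [Finset.sum_insert ha, Finset.sum_insert ha, ← ih]; rfl

theorem norm_C0_le {f : C₀(Y, ℂ)} {C : ℝ} (hC : 0 ≤ C) (h : ∀ y, ‖f y‖ ≤ C) : ‖f‖ ≤ C :=
  (BoundedContinuousFunction.norm_le (f := f.toBCF) hC).2 h

/-- A partition of unity acts as a resolution of the identity on a non-degenerate module. -/
theorem hasSum_partition
    (hρ : (Submodule.span ℂ {h : 𝓗 | ∃ (f : C₀(Y, ℂ)) (k : 𝓗), h = ρ f k}).topologicalClosure = ⊤)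
    (φ : PartitionOfUnity J Y Set.univ) (f : J → C₀(Y, ℂ)) (hf : ∀ j y, f j y = (φ j y : ℂ))
    (h : 𝓗) : HasSum (fun j => ρ (f j) h) h := by
  classical
  have hsum : ∀ (F : Finset J) y, (∑ j ∈ F, f j) y = ((∑ j ∈ F, φ j y : ℝ) : ℂ) := fun F y => by
    rw [sum_apply_C0]; simp [hf]
  have hbound : ∀ F : Finset J, ‖ρ (∑ j ∈ F, f j)‖ ≤ 1 := fun F => by
    refine (NonUnitalStarAlgHom.norm_apply_le ρ _).trans (norm_C0_le zero_le_one fun y => ?_)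
    rw [hsum, Complex.norm_real, Real.norm_of_nonneg (Finset.sum_nonneg fun j _ => φ.nonneg j y)]
    exact sum_le_one_of_partition φ F y
  have hpart : ∀ h (F : Finset J), ∑ j ∈ F, ρ (f j) h = ρ (∑ j ∈ F, f j) h := fun h F => by
    rw [map_sum, _root_.sum_apply]
  let W : Submodule ℂ 𝓗 :=
    { carrier := {h | HasSum (fun j => ρ (f j) h) h}
      add_mem' := fun {a b} ha hb => by simpa using! HasSum.add ha hb
      zero_mem' := by simp
      smul_mem' := fun c x hx => by simpa using! HasSum.const_smul c hx }
  have hclosed : IsClosed (W : Set 𝓗) := by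
    refine isClosed_of_closure_subset fun x hx => ?_
    change HasSum _ _
    rw [HasSum, SummationFilter.unconditional_filter, Metric.tendsto_atTop]
    intro ε hε
    obtain ⟨y, hy, hxy⟩ := Metric.mem_closure_iff.1 hx (ε / 3) (by positivity)
    change HasSum _ _ at hy
    rw [HasSum, SummationFilter.unconditional_filter, Metric.tendsto_atTop] at hy
    obtain ⟨F₀, hF₀⟩ := hy (ε / 3) (by positivity)
    refine ⟨F₀, fun F hF => ?_⟩
    have h1 := hF₀ F hF
    have h2 : dist (∑ j ∈ F, ρ (f j) x) (∑ j ∈ F, ρ (f j) y) ≤ dist x y := by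
      rw [hpart, hpart, dist_eq_norm, dist_eq_norm, ← map_sub]
      exact (ContinuousLinearMap.le_of_opNorm_le _ (hbound F) _).trans (one_mul _).le
    have h3 := dist_triangle4 (∑ j ∈ F, ρ (f j) x) (∑ j ∈ F, ρ (f j) y) y x
    rw [dist_comm y x] at h3
    linarith
  have hgen : ∀ (g : C₀(Y, ℂ)) (k : 𝓗), ρ g k ∈ W := fun g k => by
    have hlim : Filter.Tendsto (fun F : Finset J => (∑ j ∈ F, f j) * g) Filter.atTop (𝓝 g) := by
      rw [Metric.tendsto_atTop]
      intro ε hε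
      obtain ⟨K, hK, hKg⟩ : ∃ K : Set Y, IsCompact K ∧ ∀ y ∉ K, ‖g y‖ < ε / 2 := by
        have := (zero_at_infty g).norm.eventually_lt_const (u := ε / 2)
          (by rw [norm_zero]; positivity)
        obtain ⟨K, hK, hKs⟩ := Filter.mem_cocompact.1 this
        exact ⟨K, hK, fun y hy => hKs hy⟩
      obtain ⟨F₀, hF₀⟩ := exists_finset_sum_eq_one φ hK
      refine ⟨F₀, fun F hF => lt_of_le_of_lt ?_ (half_lt_self hε)⟩
      rw [dist_eq_norm]
      refine norm_C0_le (by positivity) fun y => ?_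
      rw [ZeroAtInftyContinuousMap.sub_apply, ZeroAtInftyContinuousMap.mul_apply, hsum]
      by_cases hy : y ∈ K
      · rw [hF₀ F hF y hy]; simp; positivity
      · have h0 : 0 ≤ ∑ j ∈ F, φ j y := Finset.sum_nonneg fun j _ => φ.nonneg j y
        have h1 := sum_le_one_of_partition φ F y
        have : ((∑ j ∈ F, φ j y : ℝ) : ℂ) * g y - g y =
            (((∑ j ∈ F, φ j y) - 1 : ℝ) : ℂ) * g y := by push_cast; ring
        rw [this, norm_mul, Complex.norm_real, Real.norm_eq_abs]
        have h2 : |(∑ j ∈ F, φ j y) - 1| ≤ 1 := by rw [abs_le]; constructor <;> linarith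
        calc _ ≤ 1 * ‖g y‖ := by gcongr
          _ ≤ ε / 2 := by rw [one_mul]; exact (hKg y hy).le
    have hρc : Continuous ρ := AddMonoidHomClass.continuous_of_bound ρ 1 fun a => by
      rw [one_mul]; exact NonUnitalStarAlgHom.norm_apply_le ρ a
    have := ((ContinuousLinearMap.apply ℂ 𝓗 k).continuous.comp hρc).continuousAt.tendsto.comp hlim
    refine this.congr fun F => ?_
    simp only [Function.comp_apply, ContinuousLinearMap.apply_apply, map_mul, hpart]
    rfl
  have htop : (⊤ : Submodule ℂ 𝓗) ≤ W := by
    rw [← hρ]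
    refine Submodule.topologicalClosure_minimal _ (Submodule.span_le.2 ?_) hclosed
    rintro _ ⟨g, k, rfl⟩
    exact hgen g k
  exact htop (Submodule.mem_top (x := h))

end Partition

section L2

variable {X : Type*} [MeasurableSpace X] {μ : Measure X}

/-- Functions in `L²` which vanish almost everywhere on `s`. -/
def VanishesOn (s : Set X) (g : Lp ℂ 2 μ) : Prop := ∀ᵐ x ∂μ, x ∈ s → g x = 0

theorem vanishesOn_iff {s : Set X} (hs : MeasurableSet s) {g : Lp ℂ 2 μ} :
    VanishesOn s g ↔ LpToLpRestrictCLM X ℂ ℂ μ 2 s g = 0 := by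
  rw [VanishesOn, ← ae_restrict_iff' hs, Lp.eq_zero_iff_ae_eq_zero]
  have := LpToLpRestrictCLM_coeFn (p := 2) (μ := μ) ℂ s g
  constructor
  · intro h
    filter_upwards [h, this] with x h₁ h₂
    rw [h₂, h₁]; rfl
  · intro h
    filter_upwards [h, this] with x h₁ h₂
    rw [← h₂, h₁]; rfl

theorem VanishesOn.inner_eq_zero {B C : Set X} (hBC : Disjoint B C) {g h : Lp ℂ 2 μ}
    (hg : VanishesOn Bᶜ g) (hh : VanishesOn Cᶜ h) : ⟪g, h⟫_ℂ = 0 := by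
  rw [L2.inner_def]
  refine integral_eq_zero_of_ae ?_
  filter_upwards [hg, hh] with x h₁ h₂
  by_cases hx : x ∈ B
  · rw [h₂ (Set.disjoint_left.1 hBC hx)]; simp
  · rw [h₁ hx]; simp

variable [MetricSpace X] [BorelSpace X]

theorem VanishesOn.supportedIn {B : Set X} {g : Lp ℂ 2 μ} (hg : VanishesOn Bᶜ g) :
    SupportedIn (mulRep μ) g B := by
  intro f hf
  change mulOp μ f g = 0
  rw [Lp.eq_zero_iff_ae_eq_zero]
  filter_upwards [mulOp_ae μ f g, hg] with x h₁ h₂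
  rw [h₁]
  by_cases hx : x ∈ B
  · have : f x = 0 := by
      by_contra h
      exact Set.disjoint_left.1 hf (subset_tsupport _ h) hx
    simp [this]
  · simp [h₂ hx]

/-- A non-empty open set of positive finite volume without isolated points supports infinitely
many orthonormal functions. -/
theorem exists_orthonormal_seq [PerfectSpace X] {B : Set X} (hB : IsOpen B) (hne : B.Nonempty)
    (hpos : ∀ U : Set X, IsOpen U → U.Nonempty → μ U ≠ 0) (hfin : μ B ≠ ⊤) :
    ∃ g : ℕ → Lp ℂ 2 μ, Orthonormal ℂ g ∧ ∀ n, VanishesOn Bᶜ (g n) := by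
  obtain ⟨b, hb⟩ := hne
  have : Infinite B := (infinite_of_mem_nhds b (hB.mem_nhds hb)).to_subtype
  obtain ⟨G, hGi, hGo, hGd⟩ := exists_seq_infinite_isOpen_pairwise_disjoint B
  let G' : ℕ → Set X := fun n => (↑) '' G n
  have hGo' : ∀ n, IsOpen (G' n) := fun n => hB.isOpenMap_subtype_val _ (hGo n)
  have hGB : ∀ n, G' n ⊆ B := fun n => Subtype.coe_image_subset _ _
  have hGf : ∀ n, μ (G' n) ≠ ⊤ := fun n => measure_ne_top_of_subset (hGB n) hfin
  have hGp : ∀ n, 0 < μ.real (G' n) := fun n => by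
    refine ENNReal.toReal_pos (hpos _ (hGo' n) ((hGi n).nonempty.image _)) (hGf n)
  have hGd' : Pairwise fun m n => Disjoint (G' m) (G' n) := fun m n hmn =>
    (Set.disjoint_image_iff Subtype.val_injective).2 (hGd hmn)
  let g : ℕ → Lp ℂ 2 μ := fun n =>
    indicatorConstLp 2 (hGo' n).measurableSet (hGf n) (((√(μ.real (G' n)))⁻¹ : ℝ) : ℂ)
  refine ⟨g, ?_, fun n => ?_⟩
  · classical
    rw [orthonormal_iff_ite]
    intro m n
    simp only [g]
    rw [L2.inner_indicatorConstLp_indicatorConstLp (hμs := hGf m) (hμt := hGf n)]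
    split_ifs with h
    · subst h
      rw [Set.inter_self]
      have h1 := hGp m
      simp only [RCLike.inner_apply, Complex.conj_ofReal]
      rw [← Complex.ofReal_mul, Complex.real_smul, ← Complex.ofReal_mul, ← mul_inv,
        Real.mul_self_sqrt h1.le, mul_inv_cancel₀ h1.ne', Complex.ofReal_one]
    · rw [(hGd' h).inter_eq]; simp
  · filter_upwards [indicatorConstLp_coeFn (p := 2) (hs := (hGo' n).measurableSet) (hμs := hGf n)
      (c := (((√(μ.real (G' n)))⁻¹ : ℝ) : ℂ))] with x hx hxB
    rw [hx, Set.indicator_of_notMem fun h => hxB (hGB n h)]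

theorem countable_of_orthonormal {𝓗 ι : Type*} [NormedAddCommGroup 𝓗] [InnerProductSpace ℂ 𝓗]
    [TopologicalSpace.SeparableSpace 𝓗] {v : ι → 𝓗} (hv : Orthonormal ℂ v) : Countable ι := by
  refine Set.countable_univ_iff.1 (Set.PairwiseDisjoint.countable_of_isOpen
    (s := fun i => Metric.ball (v i) (1/2)) ?_ (fun i _ => Metric.isOpen_ball) fun i _ => ⟨v i, by simp⟩)
  intro i _ j _ hij
  refine Metric.ball_disjoint_ball ?_
  have h1 : ‖v i - v j‖ ^ 2 = 2 := by
    rw [@norm_sub_sq ℂ, hv.1, hv.1, hv.2 hij]; norm_num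
  rw [dist_eq_norm]
  nlinarith [norm_nonneg (v i - v j)]

/-- Every separable Hilbert space embeds into the functions supported in an open set. -/
theorem exists_isometry_supported [PerfectSpace X] {B : Set X} (hB : IsOpen B) (hne : B.Nonempty)
    (hpos : ∀ U : Set X, IsOpen U → U.Nonempty → μ U ≠ 0) (hfin : μ B ≠ ⊤)
    (𝓗 : Type*) [NormedAddCommGroup 𝓗] [InnerProductSpace ℂ 𝓗] [CompleteSpace 𝓗]
    [TopologicalSpace.SeparableSpace 𝓗] :
    ∃ U : 𝓗 →ₗᵢ[ℂ] Lp ℂ 2 μ, ∀ h, VanishesOn Bᶜ (U h) := by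
  obtain ⟨g, hg, hgB⟩ := exists_orthonormal_seq hB hne hpos hfin
  obtain ⟨w, b, -⟩ := exists_hilbertBasis ℂ 𝓗
  have : Countable w := countable_of_orthonormal b.orthonormal
  obtain ⟨k, hk⟩ := exists_injective_nat w
  have hgk : Orthonormal ℂ fun i : w => g (k i) := hg.comp k hk
  let S := hgk.orthogonalFamily.linearIsometry
  refine ⟨S.comp b.repr.toLinearIsometry, fun h => ?_⟩
  rw [vanishesOn_iff hB.measurableSet.compl]
  have := (hgk.orthogonalFamily.hasSum_linearIsometry (b.repr h)).mapL
    (LpToLpRestrictCLM X ℂ ℂ μ 2 Bᶜ)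
  refine this.unique ?_
  have h0 : ∀ i : w, LpToLpRestrictCLM X ℂ ℂ μ 2 Bᶜ (g (k i)) = 0 := fun i =>
    (vanishesOn_iff hB.measurableSet.compl).1 (hgB _)
  simp [h0, hasSum_zero]

end L2

end Roe

namespace Roe

open scoped InnerProductSpace Topology
open ContinuousLinearMap (adjoint)

section Balls

theorem exists_injective_choice {α : Type*} (A : ℕ → Set α) (hA : ∀ n, (A n).Infinite) :
    ∃ f : ℕ → α, Function.Injective f ∧ ∀ n, f n ∈ A n := by
  classical
  choose g hgA hg using fun (n : ℕ) (F : Finset α) => (hA n).exists_notMem_finset F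
  let F : ℕ → Finset α := fun n => Nat.rec ∅ (fun n F => insert (g n F) F) n
  have hF : ∀ n, F (n + 1) = insert (g n (F n)) (F n) := fun n => rfl
  have hmono : Monotone F := monotone_nat_of_le_succ fun n => by
    rw [hF]; exact Finset.subset_insert _ _
  have hlt : ∀ m n, m < n → g m (F m) ≠ g n (F n) := fun m n hmn h => by
    refine hg n (F n) (h ▸ hmono (Nat.succ_le_of_lt hmn) ?_)
    rw [Nat.succ_eq_add_one, hF]
    exact Finset.mem_insert_self _ _
  refine ⟨fun n => g n (F n), fun m n h => ?_, fun n => hgA _ _⟩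
  rcases lt_trichotomy m n with hmn | hmn | hmn
  · exact absurd h (hlt m n hmn)
  · exact hmn
  · exact absurd h.symm (hlt n m hmn)

variable {X : Type*} [MetricSpace X]

/-- Near a locally finite family of points of a space without isolated points one can choose a
locally finite disjoint family of non-empty open sets. -/
theorem exists_disjoint_open [PerfectSpace X] {J : Type*} [Countable J] (x : J → X)
    (hx : ∀ z, ∃ ε > 0, {j | x j ∈ Metric.ball z ε}.Finite) :
    ∃ B : J → Set X, (∀ j, IsOpen (B j)) ∧ (∀ j, (B j).Nonempty) ∧
      (Pairwise fun j k => Disjoint (B j) (B k)) ∧ (∀ j, B j ⊆ Metric.ball (x j) 2) ∧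
      LocallyFinite B := by
  rcases isEmpty_or_nonempty J with hJ | hJ
  · exact ⟨fun _ => ∅, fun j => hJ.elim j, fun j => hJ.elim j, fun j => hJ.elim j,
      fun j => hJ.elim j, fun z => ⟨Set.univ, Filter.univ_mem, Set.toFinite _⟩⟩
  obtain ⟨e, he⟩ := exists_injective_nat J
  have hpos : ∀ n : ℕ, (0 : ℝ) < 1 / (n + 1) := fun n => by positivity
  obtain ⟨Y, hY, hYx⟩ := exists_injective_choice
    (fun n => Metric.ball (x (Function.invFun e n)) (1 / (n + 1)))
    fun n => infinite_of_mem_nhds _ (Metric.ball_mem_nhds _ (hpos n))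
  let y : J → X := fun j => Y (e j)
  have hyx : ∀ j, dist (y j) (x j) < 1 / (e j + 1) := fun j => by
    have := hYx (e j)
    rwa [Function.leftInverse_invFun he j] at this
  have hlf : ∀ z, ∃ ε > 0, {j | (Metric.ball (x j) (2 / (e j + 1)) ∩
      Metric.ball z ε).Nonempty}.Finite := fun z => by
    obtain ⟨ε, hε, hfin⟩ := hx z
    obtain ⟨N, hN⟩ := exists_nat_one_div_lt (K := ℝ) (ε := ε / 4) (by positivity)
    refine ⟨ε / 2, by positivity,
      (hfin.union ((Set.finite_lt_nat N).preimage he.injOn)).subset fun j hj => ?_⟩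
    obtain ⟨b, hb, hbz⟩ := hj
    by_cases hjN : e j < N
    · exact Or.inr hjN
    · left
      have h1 : (2 : ℝ) / (e j + 1) ≤ 2 / (N + 1) := by
        have : (N : ℝ) ≤ e j := by exact_mod_cast not_lt.1 hjN
        gcongr
      have h2 : (2 : ℝ) / (N + 1) = 2 * (1 / (N + 1)) := by ring
      have h3 := dist_triangle_left (x j) z b
      rw [Metric.mem_ball] at hb hbz
      change x j ∈ Metric.ball z ε
      rw [Metric.mem_ball]
      linarith
  have hsep : ∀ j, ∃ r > 0, ∀ k, k ≠ j → r ≤ dist (y k) (y j) := fun j => by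
    obtain ⟨ε, hε, hfin⟩ := hlf (y j)
    have hfin' : {k | y k ∈ Metric.ball (y j) ε}.Finite := hfin.subset fun k hk =>
      ⟨y k, by
        rw [Metric.mem_ball]
        refine (hyx k).trans_le ?_
        gcongr
        norm_num, hk⟩
    have hcl := ((hfin'.subset (Set.sep_subset _ fun k => k ≠ j)).image y).isClosed
    obtain ⟨η, hη, hηs⟩ := Metric.isOpen_iff.1 hcl.isOpen_compl (y j) (by
      rintro ⟨k, hk, hkj⟩
      exact hk.2 (he (hY hkj)))
    refine ⟨min ε η, lt_min hε hη, fun k hk => ?_⟩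
    by_contra! h
    rw [lt_min_iff] at h
    exact hηs (Metric.mem_ball.2 h.2) ⟨k, ⟨Metric.mem_ball.2 h.1, hk⟩, rfl⟩
  choose r hr hrs using hsep
  let δ : J → ℝ := fun j => min (r j / 2) (1 / (e j + 1))
  have hδ : ∀ j, 0 < δ j := fun j => lt_min (half_pos (hr j)) (hpos _)
  have hsub : ∀ j, Metric.ball (y j) (δ j) ⊆ Metric.ball (x j) (2 / (e j + 1)) := fun j =>
    Metric.ball_subset_ball' (by
      have h1 : δ j ≤ 1 / (e j + 1) := min_le_right _ _
      have h2 : (2 : ℝ) / (e j + 1) = 1 / (e j + 1) + 1 / (e j + 1) := by ring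
      linarith [(hyx j).le])
  refine ⟨fun j => Metric.ball (y j) (δ j), fun j => Metric.isOpen_ball,
    fun j => ⟨y j, Metric.mem_ball_self (hδ j)⟩, fun j k hjk => ?_, fun j => ?_, fun z => ?_⟩
  · refine Metric.ball_disjoint_ball ?_
    have h1 : δ j ≤ r j / 2 := min_le_left _ _
    have h2 : δ k ≤ r k / 2 := min_le_left _ _
    have h3 := hrs j k hjk.symm
    have h4 := hrs k j hjk
    rw [dist_comm] at h3
    linarith
  · refine (hsub j).trans (Metric.ball_subset_ball ?_)
    rw [div_le_iff₀ (by positivity)]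
    have : (0 : ℝ) ≤ e j := Nat.cast_nonneg _
    linarith
  · obtain ⟨ε, hε, hfin⟩ := hlf z
    exact ⟨Metric.ball z ε, Metric.ball_mem_nhds z hε,
      hfin.subset fun j hj => hj.mono (Set.inter_subset_inter_left _ (hsub j))⟩

end Balls

section Existence

/-- A countable locally finite partition of unity with small compact supports. -/
theorem exists_partition (Y : Type*) [MetricSpace Y] [LocallyCompactSpace Y]
    [SecondCountableTopology Y] :
    ∃ (s : Set Y) (φ : PartitionOfUnity s Y Set.univ), s.Countable ∧
      ∀ j, IsCompact (tsupport (φ j)) ∧ tsupport (φ j) ⊆ Metric.closedBall (j : Y) 1 := by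
  have h : ∀ y : Y, ∃ K : Set Y, IsCompact K ∧ K ⊆ Metric.closedBall y 1 ∧ K ∈ 𝓝 y := fun y => by
    obtain ⟨K, hK, hKs, hKc⟩ := local_compact_nhds (Metric.closedBall_mem_nhds y zero_lt_one)
    exact ⟨K, hKc, hKs, hK⟩
  choose K hK hKs hKn using h
  obtain ⟨s, hs, hcov⟩ := TopologicalSpace.countable_cover_nhds
    fun y => interior_mem_nhds.2 (hKn y)
  obtain ⟨φ, hφ⟩ := PartitionOfUnity.exists_isSubordinate isClosed_univ
    (fun j : s => interior (K j)) (fun j => isOpen_interior) (by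
      rw [← hcov, Set.biUnion_eq_iUnion])
  have hsub : ∀ j, tsupport (φ j) ⊆ K j := fun j => (hφ j).trans interior_subset
  exact ⟨s, φ, hs, fun j => ⟨(hK j).of_isClosed_subset (isClosed_tsupport _) (hsub j),
    (hsub j).trans (hKs j)⟩⟩

/-- The square roots of the functions of a partition of unity as elements of `C₀(Y)`. -/
theorem exists_sqrt_C0 {Y J : Type*} [MetricSpace Y] (φ : PartitionOfUnity J Y Set.univ)
    (hφ : ∀ j, IsCompact (tsupport (φ j))) :
    ∃ ψ : J → C₀(Y, ℂ), (∀ j y, ψ j y = (√(φ j y) : ℂ)) ∧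
      ∀ j, tsupport (ψ j) ⊆ tsupport (φ j) := by
  have hsupp : ∀ j, tsupport (fun y => (√(φ j y) : ℂ)) ⊆ tsupport (φ j) := fun j => by
    refine closure_mono fun y hy h => hy ?_
    change φ j y = 0 at h
    simp [h]
  have hcont : ∀ j, Continuous fun y => (√(φ j y) : ℂ) := fun j => by
    have := (φ j).continuous
    fun_prop
  refine ⟨fun j => ⟨⟨_, hcont j⟩, ?_⟩, fun j y => rfl, hsupp⟩
  exact HasCompactSupport.is_zero_at_infty
    ((hφ j).of_isClosed_subset (isClosed_tsupport _) (hsupp j))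

variable {X Y : Type*} [MetricSpace X] [MeasurableSpace X] [BorelSpace X] [PerfectSpace X]
  [MetricSpace Y] [LocallyCompactSpace Y] [SecondCountableTopology Y] {μ : Measure X}
  {𝓗 : Type*} [NormedAddCommGroup 𝓗] [InnerProductSpace ℂ 𝓗] [CompleteSpace 𝓗]

/-- Existence of covering isometries from ample modules into `L²`. -/
theorem exists_covers (hpos : ∀ U : Set X, IsOpen U → U.Nonempty → μ U ≠ 0)
    (hfin : ∀ (x : X) (R : ℝ), μ (Metric.ball x R) ≠ ⊤)
    {ρ : C₀(Y, ℂ) →⋆ₙₐ[ℂ] (𝓗 →L[ℂ] 𝓗)} (hρ : IsAmple ρ) {i : Y → X} (hi : Isometry i)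
    (hcl : IsClosed (Set.range i)) :
    ∃ (s : Set Y) (J : Set s) (U : J → 𝓗 →L[ℂ] Lp ℂ 2 μ) (ψ : J → C₀(Y, ℂ)) (B : J → Set X)
      (V : 𝓗 →L[ℂ] Lp ℂ 2 μ), Covers ρ (mulRep μ) i 4 U ψ B V := by
  classical
  have := hρ.separable
  obtain ⟨s, φ, hs, hφ⟩ := exists_partition Y
  have : Countable s := hs
  obtain ⟨ψ, hψ, hψs⟩ := exists_sqrt_C0 φ fun j => (hφ j).1
  let J : Set s := {j | (tsupport (φ j)).Nonempty}
  choose x hx using fun j : J => j.2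
  have hlf : ∀ z, ∃ ε > 0, {j : J | i (x j) ∈ Metric.ball z ε}.Finite := fun z => by
    by_cases hz : z ∈ Set.range i
    · obtain ⟨y, rfl⟩ := hz
      obtain ⟨t, ht, htf⟩ := φ.locallyFinite_tsupport y
      obtain ⟨ε, hε, hεt⟩ := Metric.mem_nhds_iff.1 ht
      refine ⟨ε, hε, (htf.preimage Subtype.val_injective.injOn).subset fun j hj => ?_⟩
      change ((tsupport (φ j)) ∩ t).Nonempty
      refine ⟨x j, hx j, hεt ?_⟩
      change i (x j) ∈ Metric.ball (i y) ε at hj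
      rwa [Metric.mem_ball, hi.dist_eq] at hj
    · obtain ⟨ε, hε, hεz⟩ := Metric.isOpen_iff.1 hcl.isOpen_compl z hz
      refine ⟨ε, hε, Set.finite_empty.subset fun j hj => hεz hj ⟨x j, rfl⟩⟩
  obtain ⟨B, hBo, hBn, hBd, hBx, hBl⟩ := exists_disjoint_open (fun j => i (x j)) hlf
  choose U hU using fun j => exists_isometry_supported (hBo j) (hBn j) hpos
    (measure_ne_top_of_subset (hBx j) (hfin _ _)) 𝓗
  have hUo : OrthogonalFamily ℂ (fun _ : J => 𝓗) U := fun j k hjk a b =>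
    (hU j a).inner_eq_zero (hBd hjk) (hU k b)
  have hstar : ∀ j, star (ψ j) = ψ j := fun j => by
    ext y
    rw [ZeroAtInftyContinuousMap.star_apply, hψ]
    simp
  have hsq : ∀ h : 𝓗, HasSum (fun j : J => ‖ρ (ψ j) h‖ ^ 2) (‖h‖ ^ 2) := fun h => by
    have h1 := hasSum_partition hρ.nondegenerate φ (fun j => ψ j * ψ j) (fun j y => by
      rw [ZeroAtInftyContinuousMap.mul_apply, hψ, ← Complex.ofReal_mul,
        Real.mul_self_sqrt (φ.nonneg j y)]) h
    have h2 : HasSum (fun j => ‖ρ (ψ j) h‖ ^ 2) (‖h‖ ^ 2) := by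
      have h3 := (h1.mapL (innerSL ℂ h)).mapL (RCLike.reCLM (K := ℂ))
      simp only [innerSL_apply_apply, RCLike.reCLM_apply, inner_self_eq_norm_sq] at h3
      have h4 : ∀ j, RCLike.re ⟪h, ρ (ψ j * ψ j) h⟫_ℂ = ‖ρ (ψ j) h‖ ^ 2 := fun j => by
        have h5 := inner_rep (ρ := ρ) (ψ j) h (ρ (ψ j) h)
        rw [hstar] at h5
        rw [map_mul, mul_apply_eq_comp, ← h5, inner_self_eq_norm_sq]
      simp only [h4] at h3
      exact h3
    refine (hasSum_subtype_iff_of_support_subset fun j hj => ?_).2 h2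
    by_contra hne
    refine hj ?_
    have h4 : ψ j = 0 := by
      ext y
      by_contra hy
      exact hne ⟨y, hψs j (subset_tsupport _ hy)⟩
    simp [h4]
  have hmem : ∀ h : 𝓗, Memℓp (fun j : J => ρ (ψ j) h) 2 := fun h => by
    refine memℓp_gen ?_
    simpa using (hsq h).summable
  let L : 𝓗 →ₗᵢ[ℂ] lp (fun _ : J => 𝓗) 2 :=
    { toFun := fun h => ⟨fun j => ρ (ψ j) h, hmem h⟩
      map_add' := fun a b => Subtype.ext (funext fun j => map_add (ρ (ψ j)) a b)
      map_smul' := fun c a => Subtype.ext (funext fun j => map_smul (ρ (ψ j)) c a)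
      norm_map' := fun h => by
        have h1 := lp.norm_rpow_eq_tsum (p := 2) (by norm_num)
          (⟨fun j => ρ (ψ j) h, hmem h⟩ : lp (fun _ : J => 𝓗) 2)
        have h2 : ‖(⟨fun j => ρ (ψ j) h, hmem h⟩ : lp (fun _ : J => 𝓗) 2)‖ ^ 2 = ‖h‖ ^ 2 := by
          rw [← (hsq h).tsum_eq]
          simpa using h1
        exact (sq_eq_sq₀ (norm_nonneg _) (norm_nonneg _)).1 h2 }
  refine ⟨s, J, fun j => (U j).toContinuousLinearMap, fun j => ψ j, B,
    (hUo.linearIsometry.comp L).toContinuousLinearMap, ?_⟩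
  refine ⟨LinearIsometry.adjoint_comp_self _, fun h => hUo.hasSum_linearIsometry (L h),
    fun j h => (hU j h).supportedIn, fun j => ?_, fun j => hstar j, fun j y hy b hb => ?_,
    fun K hK => ?_⟩
  · exact (hφ j).1.of_isClosed_subset (isClosed_tsupport _) (hψs j)
  · have h1 := Metric.mem_ball.1 (hBx j hb)
    have h2 := Metric.mem_closedBall.1 ((hφ j).2 (hψs j hy))
    have h3 := Metric.mem_closedBall.1 ((hφ j).2 (hx j))
    have h4 := dist_triangle b (i (x j)) (i y)
    have h5 := dist_triangle_right (x j) y (j : s)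
    rw [hi.dist_eq] at h4
    linarith
  · refine (hBl.finite_nonempty_inter_compact hK).subset fun j hj => ?_
    obtain ⟨b, hbK, hb⟩ := Set.not_disjoint_iff.1 hj
    exact ⟨b, hb, hbK⟩

end Existence

end Roe

/-! ## Decay estimates -/

section Schur

open scoped InnerProductSpace

/-- Schur test for the Gram matrix. -/
theorem IsBessel.of_gram {ι H : Type*} [NormedAddCommGroup H] [InnerProductSpace ℂ H] {u : ι → H}
    {B : ℝ} (hB : 0 ≤ B) (h : ∀ (F : Finset ι), ∀ i ∈ F, ∑ j ∈ F, ‖⟪u i, u j⟫_ℂ‖ ≤ B ^ 2) :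
    IsBessel B u := by
  intro F c
  rw [← Real.sqrt_sq hB, ← Real.sqrt_mul (sq_nonneg B)]
  refine Real.le_sqrt_of_sq_le ?_
  have h1 : ‖∑ i ∈ F, c i • u i‖ ^ 2 ≤ ∑ i ∈ F, ∑ j ∈ F, ‖c i‖ * ‖c j‖ * ‖⟪u i, u j⟫_ℂ‖ := by
    rw [← inner_self_eq_norm_sq (𝕜 := ℂ)]
    refine (RCLike.re_le_norm _).trans ?_
    simp only [sum_inner, inner_sum, inner_smul_left, inner_smul_right, Finset.mul_sum]
    refine (norm_sum_le _ _).trans (Finset.sum_le_sum fun i _ => (norm_sum_le _ _).trans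
      (Finset.sum_le_sum fun j _ => ?_))
    rw [norm_mul, norm_mul, RCLike.norm_conj, norm_inner_symm, mul_assoc]
  have h2 : ∑ i ∈ F, ∑ j ∈ F, ‖c i‖ ^ 2 * ‖⟪u i, u j⟫_ℂ‖ ≤ B ^ 2 * ∑ i ∈ F, ‖c i‖ ^ 2 := by
    rw [Finset.mul_sum]
    refine Finset.sum_le_sum fun i hi => ?_
    rw [← Finset.mul_sum, mul_comm]
    exact mul_le_mul_of_nonneg_right (h F i hi) (sq_nonneg _)
  have h3 : ∑ i ∈ F, ∑ j ∈ F, ‖c j‖ ^ 2 * ‖⟪u i, u j⟫_ℂ‖ ≤ B ^ 2 * ∑ i ∈ F, ‖c i‖ ^ 2 := by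
    rw [Finset.sum_comm]
    refine le_trans (le_of_eq ?_) h2
    refine Finset.sum_congr rfl fun i _ => Finset.sum_congr rfl fun j _ => ?_
    rw [norm_inner_symm]
  have h4 : ∑ i ∈ F, ∑ j ∈ F, ‖c i‖ * ‖c j‖ * ‖⟪u i, u j⟫_ℂ‖ ≤
      ∑ i ∈ F, ∑ j ∈ F, (‖c i‖ ^ 2 * ‖⟪u i, u j⟫_ℂ‖ + ‖c j‖ ^ 2 * ‖⟪u i, u j⟫_ℂ‖) / 2 := by
    refine Finset.sum_le_sum fun i _ => Finset.sum_le_sum fun j _ => ?_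
    have : 0 ≤ (‖c i‖ - ‖c j‖) ^ 2 * ‖⟪u i, u j⟫_ℂ‖ := by positivity
    nlinarith
  simp only [← Finset.sum_div, Finset.sum_add_distrib] at h4
  linarith

end Schur

namespace Wannier

open scoped InnerProductSpace

theorem enorm_inner_le_lintegral {X : Type*} [MeasurableSpace X] {μ : Measure X} (f g : Lp ℂ 2 μ) : ‖⟪f, g⟫_ℂ‖ₑ ≤ ∫⁻ x, ‖f x‖ₑ * ‖g x‖ₑ ∂μ := by
  rw [L2.inner_def]
  refine (enorm_integral_le_lintegral_enorm _).trans (lintegral_mono fun x => ?_)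
  rw [RCLike.inner_apply, enorm_mul, mul_comm]
  simp [enorm_eq_nnnorm]

variable {X : Type*} [MetricSpace X]

/-- The kernel `(1 + d(x, y))^(-m)` with values in `[0, ∞]`. -/
def decayKernel (m : ℝ) (x y : X) : ℝ≥0∞ := ENNReal.ofReal ((1 + dist x y) ^ (-m))

theorem continuous_decayKernel (m : ℝ) (y : X) : Continuous fun x => decayKernel m x y := by
  refine ENNReal.continuous_ofReal.comp ?_
  exact Continuous.rpow_const (by fun_prop) fun x => Or.inl (by positivity)

theorem decayKernel_comm (m : ℝ) (x y : X) : decayKernel m x y = decayKernel m y x := by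
  rw [decayKernel, decayKernel, dist_comm]

theorem finite_of_sum_decayKernel {Γ : Set X} {m : ℝ} (hm : 0 < m) {M : ℝ≥0∞} (hM : M ≠ ⊤)
    (h : ∀ (x : X) (F : Finset Γ), ∑ γ ∈ F, decayKernel m x γ ≤ M) (x : X) (R : ℝ) :
    {γ : Γ | dist x γ < R}.Finite := by
  by_contra hinf
  rcases le_or_gt R 0 with hR | hR
  · refine hinf (Set.finite_empty.subset fun γ hγ => ?_)
    exact absurd (lt_of_lt_of_le hγ hR) (not_lt.2 dist_nonneg)
  set c := ENNReal.ofReal ((1 + R) ^ (-m)) with hc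
  have hc0 : c ≠ 0 := by
    rw [hc, Ne, ENNReal.ofReal_eq_zero, not_le]; positivity
  obtain ⟨N, hN⟩ := ENNReal.exists_nat_gt (ENNReal.div_ne_top hM hc0)
  obtain ⟨F, hF, hcard⟩ := Set.Infinite.exists_subset_card_eq hinf N
  have h1 : (N : ℝ≥0∞) * c ≤ M := by
    refine le_trans ?_ (h x F)
    rw [← hcard, ← nsmul_eq_mul]
    refine Finset.card_nsmul_le_sum _ _ _ fun γ hγ => ?_
    refine ENNReal.ofReal_le_ofReal (Real.rpow_le_rpow_of_nonpos (by positivity) ?_ (by linarith))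
    have : dist x γ < R := hF hγ
    linarith
  rw [← ENNReal.le_div_iff_mul_le (Or.inl hc0) (Or.inl ENNReal.ofReal_ne_top)] at h1
  exact absurd h1 (not_le.2 hN)

variable [MeasurableSpace X] {μ : Measure X}

theorem PolynomialGrowth.lintegral_decayKernel [BorelSpace X] (h : PolynomialGrowth μ) :
    ∃ m > 0, ∃ M : ℝ≥0∞, M ≠ ⊤ ∧ ∀ x : X, ∫⁻ y, decayKernel m x y ∂μ ≤ M := by
  obtain ⟨A, ν, hA, hν, hvol⟩ := h
  have hsum : Summable fun n : ℕ => A * 2 ^ ν * (1 / ((n + 1 : ℕ) : ℝ) ^ 2) :=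
    ((summable_nat_add_iff 1).2 (Real.summable_one_div_nat_pow.2 one_lt_two)).mul_left _
  refine ⟨ν + 2, by positivity, _, hsum.tsum_ofReal_ne_top, fun x => ?_⟩
  have hpt : ∀ y, decayKernel (ν + 2) x y ≤ ∑' n : ℕ, ENNReal.ofReal ((1 + n : ℝ) ^ (-(ν + 2))) *
      (Metric.ball x (n + 1)).indicator 1 y := fun y => by
    refine le_trans ?_ (ENNReal.le_tsum ⌊dist x y⌋₊)
    rw [Set.indicator_of_mem (by rw [Metric.mem_ball']; exact Nat.lt_floor_add_one _),
      Pi.one_apply, mul_one]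
    refine ENNReal.ofReal_le_ofReal (Real.rpow_le_rpow_of_nonpos (by positivity) ?_ (by linarith))
    have := Nat.floor_le (dist_nonneg (x := x) (y := y))
    linarith
  refine (lintegral_mono hpt).trans ?_
  rw [lintegral_tsum fun n => ((measurable_one.indicator
    Metric.isOpen_ball.measurableSet).const_mul _).aemeasurable]
  refine ENNReal.tsum_le_tsum fun n => ?_
  rw [lintegral_const_mul _ (measurable_one.indicator Metric.isOpen_ball.measurableSet),
    lintegral_indicator_one Metric.isOpen_ball.measurableSet]
  refine (mul_le_mul_right (hvol x (n + 1) (by positivity)) _).trans ?_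
  rw [← ENNReal.ofReal_mul (by positivity)]
  refine ENNReal.ofReal_le_ofReal ?_
  have h1 : (1 + ((n : ℝ) + 1)) ^ ν ≤ 2 ^ ν * (1 + n : ℝ) ^ ν := by
    rw [← Real.mul_rpow (by norm_num) (by positivity)]
    exact Real.rpow_le_rpow (by positivity) (by linarith) hν.le
  have h2 : (1 + n : ℝ) ^ (-(ν + 2)) * (1 + n : ℝ) ^ ν = 1 / ((n + 1 : ℕ) : ℝ) ^ 2 := by
    rw [← Real.rpow_add (by positivity)]
    rw [show -(ν + 2) + ν = -2 by ring, Real.rpow_neg (by positivity), one_div]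
    push_cast
    rw [add_comm, ← Real.rpow_natCast]
    norm_num
  calc _ ≤ (1 + n : ℝ) ^ (-(ν + 2)) * (A * (2 ^ ν * (1 + n : ℝ) ^ ν)) := by gcongr
    _ = A * 2 ^ ν * ((1 + n : ℝ) ^ (-(ν + 2)) * (1 + n : ℝ) ^ ν) := by ring
    _ = _ := by rw [h2]

theorem SmallBallsBoundedBelow.sum_decayKernel [BorelSpace X] {d : ℕ}
    (h : SmallBallsBoundedBelow d μ) {Γ : Set X} (hΓ : UniformlyDiscrete Γ) {m : ℝ} (hm : 0 < m)
    {M : ℝ≥0∞} (hM : M ≠ ⊤) (hint : ∀ x : X, ∫⁻ y, decayKernel m x y ∂μ ≤ M) :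
    ∃ M' : ℝ≥0∞, M' ≠ ⊤ ∧ ∀ (x : X) (F : Finset Γ), ∑ γ ∈ F, decayKernel m x γ ≤ M' := by
  obtain ⟨v, r₀, hv, hr₀, hvol⟩ := h
  obtain ⟨r, hr, hdisj⟩ := hΓ
  set s := min (min r r₀) 1 with hs
  have hs0 : 0 < s := lt_min (lt_min hr hr₀) one_pos
  have hc0 : ENNReal.ofReal (v * s ^ d) ≠ 0 := by
    rw [Ne, ENNReal.ofReal_eq_zero, not_le]; positivity
  refine ⟨ENNReal.ofReal (2 ^ m) * M / ENNReal.ofReal (v * s ^ d),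
    ENNReal.div_ne_top (ENNReal.mul_ne_top ENNReal.ofReal_ne_top hM) hc0, fun x F => ?_⟩
  rw [ENNReal.le_div_iff_mul_le (Or.inl hc0) (Or.inl ENNReal.ofReal_ne_top), Finset.sum_mul]
  have hpt : ∀ γ : Γ, decayKernel m x γ * ENNReal.ofReal (v * s ^ d) ≤
      ∫⁻ y in Metric.ball (γ : X) s, ENNReal.ofReal (2 ^ m) * decayKernel m x y ∂μ := fun γ => by
    calc decayKernel m x γ * ENNReal.ofReal (v * s ^ d)
        ≤ decayKernel m x γ * μ (Metric.ball (γ : X) s) := by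
          gcongr
          exact hvol γ s hs0.le ((min_le_left _ _).trans (min_le_right _ _))
      _ = ∫⁻ y in Metric.ball (γ : X) s, decayKernel m x γ ∂μ := by rw [setLIntegral_const]
      _ ≤ _ := by
          refine setLIntegral_mono' Metric.isOpen_ball.measurableSet fun y hy => ?_
          rw [decayKernel, decayKernel, ← ENNReal.ofReal_mul (by positivity)]
          refine ENNReal.ofReal_le_ofReal ?_
          have h1 : 1 + dist x y ≤ 2 * (1 + dist x γ) := by
            have h2 := dist_triangle_right x y (γ : X)
            have h3 : dist y γ < 1 := (Metric.mem_ball.1 hy).trans_le (min_le_right _ _)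
            have h4 := dist_triangle x (γ : X) y
            rw [dist_comm (γ : X)] at h4
            linarith [dist_nonneg (x := x) (y := (γ : X))]
          have h2 := Real.rpow_le_rpow_of_nonpos (z := -m) (by positivity) h1 (by linarith)
          rw [Real.mul_rpow (by norm_num) (by positivity)] at h2
          calc (1 + dist x γ) ^ (-m) = 2 ^ m * (2 ^ (-m) * (1 + dist x γ) ^ (-m)) := by
                rw [← mul_assoc, ← Real.rpow_add (by norm_num)]; simp
            _ ≤ _ := by gcongr
  refine (Finset.sum_le_sum fun γ _ => hpt γ).trans ?_
  rw [← lintegral_biUnion_finset]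
  · refine (setLIntegral_le_lintegral _ _).trans ?_
    rw [lintegral_const_mul']
    · gcongr
      exact hint x
    · exact ENNReal.ofReal_ne_top
  · intro γ _ γ' _ hne
    refine (hdisj γ.2 γ'.2 fun h => hne (Subtype.ext h)).mono ?_ ?_ <;>
    exact Metric.ball_subset_ball ((min_le_left _ _).trans (min_le_left _ _))
  · exact fun γ _ => Metric.isOpen_ball.measurableSet

/-- A family with uniform decay away from the points of `Γ` is Bessel. -/
theorem isBessel_of_decay [BorelSpace X] {Γ : Set X} {m : ℝ} {M M' : ℝ≥0∞} (hM : M ≠ ⊤)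
    (hM' : M' ≠ ⊤) (hint : ∀ x : X, ∫⁻ y, decayKernel m x y ∂μ ≤ M)
    (hsum : ∀ (x : X) (F : Finset Γ), ∑ γ ∈ F, decayKernel m x γ ≤ M') {C : ℝ} (hC : 0 ≤ C)
    {u : Γ → Lp ℂ 2 μ} (hu : ∀ γ : Γ, ∀ᵐ x ∂μ, ‖u γ x‖ ≤ C * (1 + dist x (γ : X)) ^ (-m)) :
    IsBessel (C * √(M * M').toReal) u := by
  refine IsBessel.of_gram (by positivity) fun F γ _ => ?_
  rw [mul_pow, Real.sq_sqrt ENNReal.toReal_nonneg]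
  have hu' : ∀ γ : Γ, ∀ᵐ x ∂μ, ‖u γ x‖ₑ ≤ ENNReal.ofReal C * decayKernel m x γ := fun γ => by
    filter_upwards [hu γ] with x hx
    rw [decayKernel, ← ENNReal.ofReal_mul hC, ← ofReal_norm]
    exact ENNReal.ofReal_le_ofReal hx
  have hmeas : ∀ γ : Γ, Measurable fun x => decayKernel m x (γ : X) := fun γ =>
    (continuous_decayKernel m _).measurable
  have key : ∑ γ' ∈ F, ‖⟪u γ, u γ'⟫_ℂ‖ₑ ≤ ENNReal.ofReal C ^ 2 * (M * M') := by
    calc ∑ γ' ∈ F, ‖⟪u γ, u γ'⟫_ℂ‖ₑ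
        ≤ ∑ γ' ∈ F, ∫⁻ x, ENNReal.ofReal C ^ 2 * (decayKernel m x γ * decayKernel m x γ') ∂μ := by
          refine Finset.sum_le_sum fun γ' _ => (enorm_inner_le_lintegral _ _).trans
            (lintegral_mono_ae ?_)
          filter_upwards [hu' γ, hu' γ'] with x h₁ h₂
          refine (mul_le_mul' h₁ h₂).trans (le_of_eq (by ring))
      _ = ENNReal.ofReal C ^ 2 * ∫⁻ x, decayKernel m x γ * ∑ γ' ∈ F, decayKernel m x γ' ∂μ := by
          simp only [Finset.mul_sum]
          have hmul : ∀ γ' : Γ, Measurable fun x => decayKernel m x (γ : X) * decayKernel m x γ' :=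
            fun γ' => (hmeas γ).mul (hmeas γ')
          rw [lintegral_finsetSum F fun γ' _ => hmul γ', Finset.mul_sum]
          exact Finset.sum_congr rfl fun γ' _ => lintegral_const_mul _ (hmul γ')
      _ ≤ ENNReal.ofReal C ^ 2 * ∫⁻ x, decayKernel m x γ * M' ∂μ := by
          gcongr with x
          exact hsum x F
      _ ≤ ENNReal.ofReal C ^ 2 * (M * M') := by
          rw [lintegral_mul_const _ (hmeas γ)]
          gcongr
          simpa only [decayKernel_comm m _ (γ : X)] using hint γ
  have h1 := ENNReal.toReal_mono (by finiteness) key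
  rw [ENNReal.toReal_sum fun _ _ => enorm_ne_top, ENNReal.toReal_mul, ENNReal.toReal_pow,
    ENNReal.toReal_ofReal hC] at h1
  simpa using h1

end Wannier

namespace Wannier

open scoped InnerProductSpace Topology
open ContinuousLinearMap (adjoint)
open Roe

theorem finite_not_disjoint_ball {X κ : Type*} [MetricSpace X] {x : κ → X}
    (h : ∀ (z : X) (R : ℝ), {γ | dist z (x γ) < R}.Finite) {K : Set X} (hK : IsCompact K) (R : ℝ) :
    {γ | ¬ Disjoint K (Metric.ball (x γ) R)}.Finite := by
  rcases K.eq_empty_or_nonempty with rfl | ⟨z, hz⟩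
  · simp
  obtain ⟨S, hS⟩ := hK.isBounded.subset_ball z
  refine (h z (S + R)).subset fun γ hγ => ?_
  obtain ⟨y, hyK, hy⟩ := Set.not_disjoint_iff.1 hγ
  have h1 := Metric.mem_ball'.1 (hS hyK)
  have h2 := dist_triangle z y (x γ)
  have h3 := Metric.mem_ball.1 hy
  change dist z (x γ) < S + R
  linarith

theorem SmallBallsBoundedBelow.measure_ne_zero {X : Type*} [MetricSpace X] [MeasurableSpace X] {μ : Measure X}
    {d : ℕ} (hb : SmallBallsBoundedBelow d μ) {U : Set X} (hU : IsOpen U) (hne : U.Nonempty) :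
    μ U ≠ 0 := fun h0 => by
  obtain ⟨x, hx⟩ := hne
  obtain ⟨v, r₀, hv, hr₀, hvol⟩ := hb
  obtain ⟨ε, hε, hεU⟩ := Metric.isOpen_iff.1 hU x hx
  have h1 := hvol x (min ε r₀) (lt_min hε hr₀).le (min_le_right _ _)
  have h2 := measure_mono_null ((Metric.ball_subset_ball (min_le_left ε r₀)).trans hεU) h0
  rw [h2, nonpos_iff_eq_zero, ENNReal.ofReal_eq_zero] at h1
  have : 0 < min ε r₀ := lt_min hε hr₀
  exact absurd h1 (not_le.2 (by positivity))

theorem PolynomialGrowth.measure_ball_ne_top {X : Type*} [MetricSpace X] [MeasurableSpace X]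
    {μ : Measure X} (hg : PolynomialGrowth μ) (x : X) (R : ℝ) :
    μ (Metric.ball x R) ≠ ⊤ := by
  obtain ⟨A, ν, -, -, hvol⟩ := hg
  refine measure_ne_top_of_subset (Metric.ball_subset_ball (le_max_left R 0)) ?_
  exact ne_top_of_le_ne_top ENNReal.ofReal_ne_top (hvol x (max R 0) (le_max_right _ _))

variable {X : Type*} [MetricSpace X] [MeasurableSpace X] [BorelSpace X] {μ : Measure X}

theorem exists_truncation (g : Lp ℂ 2 μ) (x : X) (R : ℝ) :
    ∃ g' : Lp ℂ 2 μ, g' =ᵐ[μ] (Metric.ball x R).indicator g :=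
  ⟨((Lp.memLp g).indicator Metric.isOpen_ball.measurableSet).toLp _, MemLp.coeFn_toLp _⟩

/-- Uniform bounds for the decay kernel on a uniformly discrete set. -/
theorem exists_decay_bounds {d : ℕ} (hg : PolynomialGrowth μ) (hb : SmallBallsBoundedBelow d μ)
    {Γ : Set X} (hΓ : UniformlyDiscrete Γ) : ∃ m > 0, ∃ M M' : ℝ≥0∞, M ≠ ⊤ ∧ M' ≠ ⊤ ∧
      (∀ x : X, ∫⁻ y, decayKernel m x y ∂μ ≤ M) ∧
      ∀ (x : X) (F : Finset Γ), ∑ γ ∈ F, decayKernel m x γ ≤ M' := by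
  obtain ⟨m, hm, M, hM, hint⟩ := hg.lintegral_decayKernel
  obtain ⟨M', hM', hsum⟩ := hb.sum_decayKernel hΓ hm hM hint
  exact ⟨m, hm, M, M', hM, hM', hint, hsum⟩

theorem finite_dist_lt {d : ℕ} (hg : PolynomialGrowth μ) (hb : SmallBallsBoundedBelow d μ)
    {Γ : Set X} (hΓ : UniformlyDiscrete Γ) (x : X) (R : ℝ) : {γ : Γ | dist x γ < R}.Finite := by
  obtain ⟨m, hm, M, M', -, hM', -, hsum⟩ := exists_decay_bounds hg hb hΓ
  exact finite_of_sum_decayKernel hm hM' hsum x R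

/-- The operator `∑ |w_γ⟩⟨e_γ|` belongs to the Roe algebra if the `w_γ` decay rapidly away from `γ`
and the `e_γ` are orthonormal and supported near `γ`. -/
theorem synthesis_mem_algebra {d : ℕ} (hg : PolynomialGrowth μ) (hb : SmallBallsBoundedBelow d μ)
    {Γ : Set X} (hΓ : UniformlyDiscrete Γ) [DecidableEq Γ] {w e : Γ → Lp ℂ 2 μ}
    (hw : ∀ m : ℝ, 0 < m → ∃ C : ℝ, 0 < C ∧ ∀ γ : Γ, ∀ᵐ x ∂μ,
      ‖w γ x‖ ≤ C * (1 + dist x (γ : X)) ^ (-m))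
    {D : ℝ} (he : ∀ γ : Γ, SupportedIn (mulRep μ) (e γ) (Metric.ball (γ : X) D))
    {S S' : lp (fun _ : Γ => ℂ) 2 →L[ℂ] Lp ℂ 2 μ} (hS : IsSynthesis S w)
    (hS' : IsSynthesis S' e) : S ∘L adjoint S' ∈ algebra (mulRep μ) := by
  obtain ⟨m, hm, M, M', hM, hM', hint, hsum⟩ := exists_decay_bounds hg hb hΓ
  obtain ⟨C₀, hC₀, hw₀⟩ := hw m hm
  obtain ⟨C, hC, hwC⟩ := hw (m + 1) (by linarith)
  set N := √(M * M').toReal with hN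
  have hN0 : 0 ≤ N := Real.sqrt_nonneg _
  refine isClosed_algebra.closure_subset (Metric.mem_closure_iff.2 fun ε hε => ?_)
  obtain ⟨R, hR, hRε⟩ : ∃ R : ℝ, 0 < R ∧ C / (1 + R) * N * ‖adjoint S'‖ < ε := by
    set Q := C * N * ‖adjoint S'‖ with hQ
    have hQ0 : 0 ≤ Q := by positivity
    refine ⟨Q / ε + 1, by positivity, ?_⟩
    have : C / (1 + (Q / ε + 1)) * N * ‖adjoint S'‖ = Q / (1 + (Q / ε + 1)) := by
      rw [hQ]; ring
    rw [this, div_lt_iff₀ (by positivity)]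
    have : ε * (1 + (Q / ε + 1)) = Q + 2 * ε := by field_simp; ring
    linarith
  choose u hu using fun γ : Γ => exists_truncation (w γ) (γ : X) R
  have hub : IsBessel (C₀ * N) u := isBessel_of_decay hM hM' hint hsum hC₀.le fun γ => by
    filter_upwards [hu γ, hw₀ γ] with x h₁ h₂
    rw [h₁]
    exact (norm_indicator_le_norm_self _ _).trans h₂
  obtain ⟨T, hT⟩ := hub.exists_isSynthesis (by positivity)
  have hdiff : IsBessel (C / (1 + R) * N) fun γ => w γ - u γ :=
    isBessel_of_decay hM hM' hint hsum (by positivity) fun γ => by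
      filter_upwards [hu γ, hwC γ, Lp.coeFn_sub (w γ) (u γ)] with x h₁ h₂ h₃
      rw [h₃, Pi.sub_apply, h₁]
      by_cases hx : x ∈ Metric.ball (γ : X) R
      · rw [Set.indicator_of_mem hx, sub_self, norm_zero]
        positivity
      · rw [Set.indicator_of_notMem hx, sub_zero]
        refine h₂.trans ?_
        rw [neg_add, Real.rpow_add (by positivity), Real.rpow_neg_one, div_mul_eq_mul_div,
          mul_comm (_ ^ _), ← mul_assoc, ← div_eq_mul_inv, div_mul_eq_mul_div]
        have : R ≤ dist x γ := not_lt.1 hx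
        gcongr
  have hnorm := (hS.sub hT).norm_le (by positivity) hdiff
  refine ⟨T ∘L adjoint S', ?_, ?_⟩
  · have hsupp : ∀ γ : Γ, SupportedIn (mulRep μ) (u γ) (Metric.ball (γ : X) (max R D)) :=
      fun γ => VanishesOn.supportedIn (by
        filter_upwards [hu γ] with x hx hxR
        rw [hx]
        exact Set.indicator_of_notMem
          (fun h => hxR (Metric.ball_subset_ball (le_max_left _ _) h)) _)
    have hsupp' : ∀ γ : Γ, SupportedIn (mulRep μ) (e γ) (Metric.ball (γ : X) (max R D)) :=
      fun γ f hf => he γ f (hf.mono_right (Metric.ball_subset_ball (le_max_right _ _)))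
    have := synthesis_local hT hS' (lt_max_of_lt_left hR) hsupp hsupp' fun K hK =>
      finite_not_disjoint_ball (finite_dist_lt hg hb hΓ) hK _
    exact mem_algebra this.1 this.2
  · rw [dist_eq_norm, ← ContinuousLinearMap.sub_comp]
    refine (ContinuousLinearMap.opNorm_comp_le _ _).trans_lt (lt_of_le_of_lt ?_ hRε)
    gcongr

/-- In an ample module there are unit vectors with small compact support near every point. -/
theorem exists_unit_vector {Y : Type*} [MetricSpace Y] [LocallyCompactSpace Y] {𝓗 : Type*}
    [NormedAddCommGroup 𝓗] [InnerProductSpace ℂ 𝓗] [CompleteSpace 𝓗]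
    {ρ : C₀(Y, ℂ) →⋆ₙₐ[ℂ] (𝓗 →L[ℂ] 𝓗)} (hρ : IsAmple ρ) (y : Y) {r : ℝ} (hr : 0 < r) :
    ∃ (g : C₀(Y, ℂ)) (k : 𝓗), tsupport g ⊆ Metric.ball y r ∧ ‖ρ g k‖ = 1 := by
  obtain ⟨s, hs, hsc⟩ := Metric.exists_isCompact_closedBall y
  set t := min s (r / 2) with ht
  have ht0 : 0 < t := lt_min hs (half_pos hr)
  let f : Y → ℂ := fun z => ((max 0 (t - dist z y) : ℝ) : ℂ)
  have hfc : Continuous f := by fun_prop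
  have hsupp : tsupport f ⊆ Metric.closedBall y t := by
    refine closure_minimal (fun z hz => ?_) Metric.isClosed_closedBall
    by_contra h
    refine hz ?_
    rw [Metric.mem_closedBall, not_le] at h
    simp only [f]
    rw [max_eq_left (by linarith), Complex.ofReal_zero]
  have hcomp : HasCompactSupport f := hsc.of_isClosed_subset (isClosed_tsupport _)
    (hsupp.trans (Metric.closedBall_subset_closedBall (min_le_left _ _)))
  let g : C₀(Y, ℂ) := ⟨⟨f, hfc⟩, hcomp.is_zero_at_infty⟩
  have hg0 : g ≠ 0 := fun h => by
    have h1 : f y = 0 := congrArg (fun g : C₀(Y, ℂ) => g y) h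
    simp only [f, dist_self, sub_zero, max_eq_right ht0.le] at h1
    exact ht0.ne' (Complex.ofReal_eq_zero.1 h1)
  have hρ0 : ρ g ≠ 0 := fun h => hg0 (hρ.not_compact g (by rw [h]; exact isCompactOperator_zero))
  obtain ⟨k, hk⟩ : ∃ k, ρ g k ≠ 0 := by
    by_contra! h
    exact hρ0 (ContinuousLinearMap.ext h)
  refine ⟨g, ((‖ρ g k‖⁻¹ : ℝ) : ℂ) • k, ?_, ?_⟩
  · refine hsupp.trans (Metric.closedBall_subset_ball ?_)
    exact (min_le_right _ _).trans_lt (half_lt_self hr)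
  · rw [map_smul, norm_smul, Complex.norm_real, norm_inv, norm_norm,
      inv_mul_cancel₀ (norm_ne_zero_iff.2 hk)]

/-- Orthonormal vectors in an ample module with uniformly small supports around a uniformly discrete
set of points. -/
theorem exists_orthonormal_supported {Y : Type*} [MetricSpace Y] [LocallyCompactSpace Y] {𝓗 : Type*}
    [NormedAddCommGroup 𝓗] [InnerProductSpace ℂ 𝓗] [CompleteSpace 𝓗]
    {ρ : C₀(Y, ℂ) →⋆ₙₐ[ℂ] (𝓗 →L[ℂ] 𝓗)} (hρ : IsAmple ρ) {κ : Type*} (y : κ → Y) {r : ℝ}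
    (hr : 0 < r) (hy : Pairwise fun i j => Disjoint (Metric.ball (y i) r) (Metric.ball (y j) r)) :
    ∃ e : κ → 𝓗, Orthonormal ℂ e ∧ ∀ i, SupportedIn ρ (e i) (Metric.ball (y i) r) := by
  choose g k hg hk using fun i => exists_unit_vector hρ (y i) hr
  have hmul : ∀ (f f' : C₀(Y, ℂ)), Disjoint (tsupport f) (tsupport f') → f * f' = 0 :=
    fun f f' h => by
      ext z
      rw [ZeroAtInftyContinuousMap.mul_apply, ZeroAtInftyContinuousMap.zero_apply, mul_eq_zero]
      by_contra! hz
      exact Set.disjoint_left.1 h (subset_tsupport _ hz.1) (subset_tsupport _ hz.2)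
  have hsupp : ∀ i, SupportedIn ρ (ρ (g i) (k i)) (Metric.ball (y i) r) := fun i f hf => by
    have := hmul f (g i) (hf.mono_right (hg i))
    rw [← mul_apply_eq_comp, ← map_mul, this, map_zero]
    rfl
  refine ⟨fun i => ρ (g i) (k i), ⟨hk, fun i j hij => ?_⟩, hsupp⟩
  change ⟪ρ (g i) (k i), ρ (g j) (k j)⟫_ℂ = 0
  rw [inner_rep, hsupp j, inner_zero_right]
  rw [tsupport_star]
  exact (hy hij).mono_left (hg i)

/-- If the synthesis operators of a family in `𝓚` and of a family in `𝓗` are isometries which are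
intertwined up to an element of the Roe algebra, then the range projection of the former has trivial
class provided that `K₀` of the Roe algebra of `𝓗` is trivial. -/
theorem exists_projection_of_isometries {Y Z : Type*} [MetricSpace Y] [MetricSpace Z]
    {𝓗 𝓚 𝓛 : Type*} [NormedAddCommGroup 𝓗] [InnerProductSpace ℂ 𝓗] [CompleteSpace 𝓗]
    [NormedAddCommGroup 𝓚] [InnerProductSpace ℂ 𝓚] [CompleteSpace 𝓚]
    [NormedAddCommGroup 𝓛] [InnerProductSpace ℂ 𝓛] [CompleteSpace 𝓛]
    {ρ : C₀(Y, ℂ) →⋆ₙₐ[ℂ] (𝓗 →L[ℂ] 𝓗)} {τ : C₀(Z, ℂ) →⋆ₙₐ[ℂ] (𝓚 →L[ℂ] 𝓚)}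
    (hK : Subsingleton (KTheory.K0 (algebra ρ))) {V : 𝓗 →L[ℂ] 𝓚} (hV : adjoint V ∘L V = 1)
    {φ : algebra ρ →⋆ₙₐ[ℂ] algebra τ} (hφ : ∀ T, (φ T : 𝓚 →L[ℂ] 𝓚) = V ∘L T ∘L adjoint V)
    {E : 𝓛 →L[ℂ] 𝓗} (hE : adjoint E ∘L E = 1) (hEmem : E ∘L adjoint E ∈ algebra ρ)
    {S : 𝓛 →L[ℂ] 𝓚} (hS : adjoint S ∘L S = 1) (hSmem : S ∘L adjoint (V ∘L E) ∈ algebra τ) :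
    ∃ (p : algebra τ) (hp : IsStarProjection p),
      (p : 𝓚 →L[ℂ] 𝓚) = S ∘L adjoint S ∧ KTheory.K0.mk p hp = 0 := by
  have hadj : ∀ c, adjoint E (E c) = c := fun c => DFunLike.congr_fun hE c
  have hSadj : ∀ c, adjoint S (S c) = c := fun c => DFunLike.congr_fun hS c
  have hVadj : ∀ c, adjoint V (V c) = c := fun c => DFunLike.congr_fun hV c
  let q : algebra ρ := ⟨E ∘L adjoint E, hEmem⟩
  have hq : IsStarProjection q := by
    refine ⟨Subtype.ext ?_, Subtype.ext ?_⟩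
    · change (E ∘L adjoint E) ∘L (E ∘L adjoint E) = E ∘L adjoint E
      ext h
      simp [hadj]
    · change adjoint (E ∘L adjoint E) = E ∘L adjoint E
      rw [ContinuousLinearMap.adjoint_comp, ContinuousLinearMap.adjoint_adjoint]
  have hq0 : KTheory.K0.mk q hq = 0 := Subsingleton.elim _ _
  let t : algebra τ := ⟨S ∘L adjoint (V ∘L E), hSmem⟩
  have ht : ((t * star t : algebra τ) : 𝓚 →L[ℂ] 𝓚) = S ∘L adjoint S := by
    change (S ∘L adjoint (V ∘L E)) ∘L adjoint (S ∘L adjoint (V ∘L E)) = _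
    ext h
    simp [ContinuousLinearMap.adjoint_comp, hadj, hVadj]
  have ht' : star t * t = φ q := by
    refine Subtype.ext ?_
    rw [hφ]
    change adjoint (S ∘L adjoint (V ∘L E)) ∘L (S ∘L adjoint (V ∘L E)) =
      V ∘L (E ∘L adjoint E) ∘L adjoint V
    ext h
    simp [ContinuousLinearMap.adjoint_comp, hSadj]
  have hp : IsStarProjection (t * star t) := by
    refine ⟨Subtype.ext ?_, IsSelfAdjoint.mul_star_self t⟩
    change ((t * star t : algebra τ) : 𝓚 →L[ℂ] 𝓚) ∘L ((t * star t : algebra τ) : 𝓚 →L[ℂ] 𝓚) =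
      ((t * star t : algebra τ) : 𝓚 →L[ℂ] 𝓚)
    rw [ht]
    ext h
    simp [hSadj]
  exact ⟨t * star t, hp, ht, KTheory.K0.mk_eq_zero_of_mul_star t rfl ht'
    (KTheory.K0.mk_map_eq_zero φ hq0 (hq.map φ))⟩

/-- The projection onto the span of a localized orthonormal family over a subset of `X₁` belongs to
the Roe algebra and its class vanishes if `K₀(C⋆(X₁))` does. -/
theorem exists_projection_class_zero [SecondCountableTopology X] [LocallyCompactSpace X]
    [PerfectSpace X] {d : ℕ} (hg : PolynomialGrowth μ) (hb : SmallBallsBoundedBelow d μ)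
    {X₁ : Set X} (hX₁ : IsClosed X₁)
    {𝓗 : Type*} [NormedAddCommGroup 𝓗] [InnerProductSpace ℂ 𝓗] [CompleteSpace 𝓗]
    {ρ : C₀(X₁, ℂ) →⋆ₙₐ[ℂ] (𝓗 →L[ℂ] 𝓗)} (hρ : IsAmple ρ)
    (hK : Subsingleton (KTheory.K0 (algebra ρ)))
    {Γ : Set X} (hΓ : UniformlyDiscrete Γ) (hΓX : Γ ⊆ X₁) [DecidableEq Γ] {w : Γ → Lp ℂ 2 μ}
    (hw : ∀ m : ℝ, 0 < m → ∃ C : ℝ, 0 < C ∧ ∀ γ : Γ, ∀ᵐ x ∂μ,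
      ‖w γ x‖ ≤ C * (1 + dist x (γ : X)) ^ (-m))
    {S : lp (fun _ : Γ => ℂ) 2 →L[ℂ] Lp ℂ 2 μ} (hS : IsSynthesis S w)
    (hSS : adjoint S ∘L S = 1) :
    ∃ (p : algebra (mulRep μ)) (hp : IsStarProjection p),
      (p : Lp ℂ 2 μ →L[ℂ] Lp ℂ 2 μ) = S ∘L adjoint S ∧ KTheory.K0.mk p hp = 0 := by
  have h := hΓ
  obtain ⟨r, hr, hdisj⟩ := h
  have : LocallyCompactSpace X₁ := hX₁.locallyCompactSpace
  let y : Γ → X₁ := fun γ => ⟨γ, hΓX γ.2⟩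
  have hcl : IsClosed (Set.range (Subtype.val : X₁ → X)) := by rwa [Subtype.range_coe]
  have h := exists_covers (fun U => hb.measure_ne_zero)
    hg.measure_ball_ne_top hρ isometry_subtype_coe hcl
  obtain ⟨s, J, U, ψ, B, V, hV⟩ := h
  have h := exists_orthonormal_supported hρ y hr fun i j hij =>
    (hdisj i.2 j.2 fun h => hij (Subtype.ext h)).preimage (Subtype.val : X₁ → X)
  obtain ⟨e, he, hesupp⟩ := h
  have h := he.exists_isSynthesis
  obtain ⟨E, hE, hEE⟩ := h
  have h := hV.exists_hom isometry_subtype_coe (by norm_num)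
  obtain ⟨φ, hφ⟩ := h
  have hEmem := synthesis_local hE hE hr hesupp hesupp fun K hK =>
    finite_not_disjoint_ball (x := y) (fun z R => finite_dist_lt hg hb hΓ (z : X) R) hK _
  have hVe : ∀ γ : Γ, SupportedIn (mulRep μ) (V (e γ)) (Metric.ball (γ : X) (r + 4)) :=
    fun γ => hV.supportedIn isometry_subtype_coe (hesupp γ)
  exact exists_projection_of_isometries hK hV.isometry hφ hEE (mem_algebra hEmem.1 hEmem.2) hSS
    (synthesis_mem_algebra hg hb hΓ hw hVe hS (hE.comp V))

/-- If an orthonormal basis of the range of a projection `P` is split into two parts, then `P` is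
the sum of the two orthogonal projections onto their spans. -/
theorem projection_eq_add_of_split {𝓚 ι : Type*} [NormedAddCommGroup 𝓚] [InnerProductSpace ℂ 𝓚]
    [CompleteSpace 𝓚] {P : 𝓚 →L[ℂ] 𝓚} (hPP : P ∘L P = P) (hPadj : adjoint P = P) {w : ι → 𝓚}
    (hw : Orthonormal ℂ w)
    (hspan : (Submodule.span ℂ (Set.range w)).topologicalClosure = LinearMap.range P.toLinearMap)
    {κ₁ κ₂ : Type*} [DecidableEq κ₁] [DecidableEq κ₂] {i₁ : κ₁ → ι} {i₂ : κ₂ → ι}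
    (hne : ∀ a b, i₁ a ≠ i₂ b) (hcover : ∀ i, (∃ a, i₁ a = i) ∨ ∃ b, i₂ b = i)
    {S₁ : lp (fun _ : κ₁ => ℂ) 2 →L[ℂ] 𝓚} (hS₁ : IsSynthesis S₁ (w ∘ i₁))
    (hSS₁ : adjoint S₁ ∘L S₁ = 1)
    {S₂ : lp (fun _ : κ₂ => ℂ) 2 →L[ℂ] 𝓚} (hS₂ : IsSynthesis S₂ (w ∘ i₂))
    (hSS₂ : adjoint S₂ ∘L S₂ = 1) :
    (S₁ ∘L adjoint S₁) ∘L (S₂ ∘L adjoint S₂) = 0 ∧ S₁ ∘L adjoint S₁ + S₂ ∘L adjoint S₂ = P := by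
  have horth : adjoint S₁ ∘L S₂ = 0 := by
    ext c
    rw [ContinuousLinearMap.comp_apply, hS₁.adjoint_apply]
    refine ((hS₂.hasSum c).mapL (innerSL ℂ _)).unique ?_
    have h0 : ∀ a b, ⟪w (i₁ a), c b • w (i₂ b)⟫_ℂ = 0 := fun a b => by
      rw [inner_smul_right, hw.2 (hne a b), mul_zero]
    simp only [innerSL_apply_apply, Function.comp_apply, h0]
    exact hasSum_zero
  have horth' : adjoint S₂ ∘L S₁ = 0 := by
    have := congrArg adjoint horth
    rwa [ContinuousLinearMap.adjoint_comp, ContinuousLinearMap.adjoint_adjoint, map_zero] at this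
  have a₁ : ∀ c, adjoint S₁ (S₁ c) = c := fun c => DFunLike.congr_fun hSS₁ c
  have a₂ : ∀ c, adjoint S₂ (S₂ c) = c := fun c => DFunLike.congr_fun hSS₂ c
  have b₁ : ∀ c, adjoint S₁ (S₂ c) = 0 := fun c => DFunLike.congr_fun horth c
  have b₂ : ∀ c, adjoint S₂ (S₁ c) = 0 := fun c => DFunLike.congr_fun horth' c
  have hPw : ∀ γ, P (w γ) = w γ := fun γ => by
    have h1 : w γ ∈ LinearMap.range P.toLinearMap := by
      rw [← hspan]
      exact Submodule.le_topologicalClosure _ (Submodule.subset_span ⟨γ, rfl⟩)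
    have h := h1
    obtain ⟨v, hv⟩ := h
    rw [← hv]
    exact DFunLike.congr_fun hPP v
  have hPS₁ : P ∘L S₁ = S₁ :=
    (hS₁.comp P).ext (by simpa only [Function.comp_def, hPw] using hS₁)
  have hPS₂ : P ∘L S₂ = S₂ :=
    (hS₂.comp P).ext (by simpa only [Function.comp_def, hPw] using hS₂)
  set Q : 𝓚 →L[ℂ] 𝓚 := S₁ ∘L adjoint S₁ + S₂ ∘L adjoint S₂ with hQ
  have hPQ : P ∘L Q = Q := by
    simp only [hQ, ContinuousLinearMap.comp_add, ← ContinuousLinearMap.comp_assoc, hPS₁, hPS₂]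
  have hQw : ∀ γ, Q (w γ) = w γ := fun γ => by
    rcases hcover γ with ⟨a, rfl⟩ | ⟨b, rfl⟩
    · rw [show w (i₁ a) = S₁ (lp.single 2 a 1) from (hS₁ a).symm]
      simp [hQ, a₁, b₂]
    · rw [show w (i₂ b) = S₂ (lp.single 2 b 1) from (hS₂ b).symm]
      simp [hQ, a₂, b₁]
  have hQP : Q ∘L P = P := by
    have hle : LinearMap.range P.toLinearMap ≤
        LinearMap.ker (Q - ContinuousLinearMap.id ℂ _).toLinearMap := by
      rw [← hspan]
      refine Submodule.topologicalClosure_minimal _ (Submodule.span_le.2 ?_)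
        (ContinuousLinearMap.isClosed_ker _)
      rintro _ ⟨γ, rfl⟩
      simp [hQw γ]
    ext v
    have := hle ⟨v, rfl⟩
    simpa [sub_eq_zero] using this
  have hQadj : adjoint Q = Q := by
    simp only [hQ, map_add, ContinuousLinearMap.adjoint_comp, ContinuousLinearMap.adjoint_adjoint]
  refine ⟨?_, ?_⟩
  · ext v
    simp [b₁]
  · have := congrArg adjoint hQP
    rwa [ContinuousLinearMap.adjoint_comp, hQadj, hPadj, hPQ] at this

/-- A projection in the Roe algebra whose range has a localized basis has trivial class. -/
theorem class_zero_of_isLocalizedBasis [SecondCountableTopology X] [LocallyCompactSpace X]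
    [PerfectSpace X] {d : ℕ} (hg : PolynomialGrowth μ) (hb : SmallBallsBoundedBelow d μ)
    {X₁ X₂ : Set X} (hX₁ : IsClosed X₁) (hX₂ : IsClosed X₂) (hX : X₁ ∪ X₂ = Set.univ)
    {𝓗₁ : Type*} [NormedAddCommGroup 𝓗₁] [InnerProductSpace ℂ 𝓗₁] [CompleteSpace 𝓗₁]
    {ρ₁ : C₀(X₁, ℂ) →⋆ₙₐ[ℂ] (𝓗₁ →L[ℂ] 𝓗₁)} (hρ₁ : IsAmple ρ₁)
    (hK₁ : Subsingleton (KTheory.K0 (algebra ρ₁)))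
    {𝓗₂ : Type*} [NormedAddCommGroup 𝓗₂] [InnerProductSpace ℂ 𝓗₂] [CompleteSpace 𝓗₂]
    {ρ₂ : C₀(X₂, ℂ) →⋆ₙₐ[ℂ] (𝓗₂ →L[ℂ] 𝓗₂)} (hρ₂ : IsAmple ρ₂)
    (hK₂ : Subsingleton (KTheory.K0 (algebra ρ₂)))
    (p : algebra (mulRep μ)) (hp : IsStarProjection p) {Γ : Set X} (hΓ : UniformlyDiscrete Γ)
    {w : Γ → Lp ℂ 2 μ}
    (hw : IsLocalizedBasis μ Γ (LinearMap.range (p : Lp ℂ 2 μ →L[ℂ] Lp ℂ 2 μ).toLinearMap) w) :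
    KTheory.K0.mk p hp = 0 := by
  classical
  have sub : ∀ Γ' : Set X, ∀ h : Γ' ⊆ Γ, UniformlyDiscrete Γ' ∧
      Orthonormal ℂ (fun γ : Γ' => w ⟨γ, h γ.2⟩) ∧
      (∀ m : ℝ, 0 < m → ∃ C : ℝ, 0 < C ∧ ∀ γ : Γ', ∀ᵐ x ∂μ,
        ‖w ⟨γ, h γ.2⟩ x‖ ≤ C * (1 + dist x (γ : X)) ^ (-m)) := fun Γ' h => by
    obtain ⟨r, hr, hd⟩ := id hΓ
    refine ⟨⟨r, hr, hd.subset h⟩, hw.orthonormal.comp _ (Set.inclusion_injective h),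
      fun m hm => ?_⟩
    obtain ⟨C, hC, hwC⟩ := hw.decay m hm
    exact ⟨C, hC, fun γ => hwC ⟨γ, h γ.2⟩⟩
  have h := sub (Γ ∩ X₁) Set.inter_subset_left
  obtain ⟨hd₁, ho₁, hw₁⟩ := h
  have h := sub (Γ \ X₁) Set.sdiff_subset
  obtain ⟨hd₂, ho₂, hw₂⟩ := h
  have h := ho₁.exists_isSynthesis
  obtain ⟨S₁, hS₁, hSS₁⟩ := h
  have h := ho₂.exists_isSynthesis
  obtain ⟨S₂, hS₂, hSS₂⟩ := h
  have h := exists_projection_class_zero hg hb hX₁ hρ₁ hK₁ hd₁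
    Set.inter_subset_right hw₁ hS₁ hSS₁
  obtain ⟨p₁, hp₁, hpS₁, h0₁⟩ := h
  have h := exists_projection_class_zero hg hb hX₂ hρ₂ hK₂ hd₂
    (fun x hx => (hX.symm.subset (Set.mem_univ x)).resolve_left hx.2) hw₂ hS₂ hSS₂
  obtain ⟨p₂, hp₂, hpS₂, h0₂⟩ := h
  have h := projection_eq_add_of_split (P := (p : Lp ℂ 2 μ →L[ℂ] Lp ℂ 2 μ))
    (congrArg Subtype.val hp.isIdempotentElem) (congrArg Subtype.val hp.isSelfAdjoint)
    hw.orthonormal hw.dense_span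
    (i₁ := fun γ : ↥(Γ ∩ X₁) => ⟨γ, γ.2.1⟩) (i₂ := fun γ : ↥(Γ \ X₁) => ⟨γ, γ.2.1⟩)
    (fun a b h => b.2.2 ((Subtype.ext_iff.1 h : (a : X) = b) ▸ a.2.2))
    (fun γ => (em ((γ : X) ∈ X₁)).imp (fun h => ⟨⟨γ, γ.2, h⟩, rfl⟩) fun h => ⟨⟨γ, γ.2, h⟩, rfl⟩)
    hS₁ hSS₁ hS₂ hSS₂
  obtain ⟨hmul, hadd⟩ := h
  rw [← hpS₁, ← hpS₂] at hmul hadd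
  exact KTheory.K0.mk_add_eq_zero (hp := hp₁) (hq := hp₂) (Subtype.ext hmul) (Subtype.ext hadd)
    h0₁ h0₂

end Wannier

namespace Roe

open scoped InnerProductSpace
open ContinuousLinearMap (adjoint)

/-- Schauder's theorem for Hilbert spaces: the adjoint of a compact operator is compact. -/
theorem isCompactOperator_adjoint {𝓗 𝓚 : Type*} [NormedAddCommGroup 𝓗] [InnerProductSpace ℂ 𝓗]
    [CompleteSpace 𝓗] [NormedAddCommGroup 𝓚] [InnerProductSpace ℂ 𝓚] [CompleteSpace 𝓚]
    {T : 𝓗 →L[ℂ] 𝓚} (hT : IsCompactOperator T) : IsCompactOperator (adjoint T) := by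
  have hc : IsCompactOperator (T ∘L adjoint T) := hT.comp_clm (adjoint T)
  have htb : TotallyBounded ((T ∘L adjoint T) '' Metric.ball 0 1) :=
    (IsCompactOperator.isCompact_closure_image_ball (f := (T ∘L adjoint T).toLinearMap)
      hc 1).totallyBounded.subset subset_closure
  refine (isCompactOperator_iff_isCompact_closure_image_ball (adjoint T).toLinearMap one_pos).2 ?_
  refine (TotallyBounded.closure (Metric.totallyBounded_iff.2 fun ε hε => ?_)).isCompact_of_isClosed
    isClosed_closure
  obtain ⟨t, hts, htf, ht⟩ := Metric.finite_approx_of_totallyBounded htb (ε ^ 2 / 2) (by positivity)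
  obtain ⟨u, hus, huf, rfl⟩ := (Set.exists_subset_image_finite_and (p := (· = t))).1
    ⟨t, hts, htf, rfl⟩
  refine ⟨adjoint T '' u, huf.image _, ?_⟩
  rintro _ ⟨x, hx, rfl⟩
  obtain ⟨_, ⟨y, hy, rfl⟩, hxy⟩ := Set.mem_iUnion₂.1 (ht ⟨x, hx, rfl⟩)
  refine Set.mem_iUnion₂.2 ⟨_, ⟨y, hy, rfl⟩, ?_⟩
  have hx1 : ‖x‖ < 1 := mem_ball_zero_iff.1 hx
  have hy1 : ‖y‖ < 1 := mem_ball_zero_iff.1 (hus hy)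
  rw [Metric.mem_ball, dist_eq_norm] at hxy ⊢
  rw [← map_sub] at hxy
  change ‖adjoint T x - adjoint T y‖ < ε
  rw [← map_sub]
  refine lt_of_pow_lt_pow_left₀ 2 hε.le ?_
  have h1 : ‖adjoint T (x - y)‖ ^ 2 = RCLike.re ⟪(T ∘L adjoint T) (x - y), x - y⟫_ℂ := by
    rw [← inner_self_eq_norm_sq (𝕜 := ℂ), ContinuousLinearMap.adjoint_inner_right]
    rfl
  rw [h1]
  have h2 : ‖x - y‖ ≤ 2 := (norm_sub_le _ _).trans (by linarith)
  calc _ ≤ ‖(T ∘L adjoint T) (x - y)‖ * ‖x - y‖ := re_inner_le_norm _ _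
    _ ≤ ‖(T ∘L adjoint T) (x - y)‖ * 2 := by gcongr
    _ < ε ^ 2 / 2 * 2 := by gcongr
    _ = ε ^ 2 := by ring

/-- The closed `⋆`-algebra of compact operators. -/
def compacts (𝓗 : Type*) [NormedAddCommGroup 𝓗] [InnerProductSpace ℂ 𝓗] [CompleteSpace 𝓗] :
    NonUnitalStarSubalgebra ℂ (𝓗 →L[ℂ] 𝓗) where
  carrier := {T | IsCompactOperator T}
  zero_mem' := isCompactOperator_zero
  add_mem' := fun h h' => h.add h'
  smul_mem' := fun c _ h => h.smul c
  mul_mem' := fun {_ T'} h _ => h.comp_clm T'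
  star_mem' := fun h => isCompactOperator_adjoint h

section Point

variable {Y : Type*} [MetricSpace Y] [Subsingleton Y] {𝓗 : Type*}
  [NormedAddCommGroup 𝓗] [InnerProductSpace ℂ 𝓗] [CompleteSpace 𝓗]
  {ρ : C₀(Y, ℂ) →⋆ₙₐ[ℂ] (𝓗 →L[ℂ] 𝓗)}

/-- Over a point the Roe algebra of an ample module consists of compact operators. -/
theorem isCompactOperator_of_mem_algebra (hρ : IsAmple ρ) {T : 𝓗 →L[ℂ] 𝓗} (hT : T ∈ algebra ρ) :
    IsCompactOperator T := by
  let f : C₀(Y, ℂ) := ⟨⟨fun _ => 1, continuous_const⟩, by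
    rw [Filter.cocompact_eq_bot]; exact Filter.tendsto_bot⟩
  have hf : ρ f = 1 := by
    have hle : (⊤ : Submodule ℂ 𝓗) ≤ LinearMap.ker (ρ f - 1).toLinearMap := by
      rw [← hρ.nondegenerate]
      refine Submodule.topologicalClosure_minimal _ (Submodule.span_le.2 ?_)
        (ContinuousLinearMap.isClosed_ker _)
      rintro _ ⟨g, k, rfl⟩
      have : f * g = g := by
        ext z
        exact one_mul (g z)
      change ρ f (ρ g k) - ρ g k = 0
      rw [← mul_apply_eq_comp, ← map_mul, this, sub_self]
    ext h
    exact sub_eq_zero.1 (hle (Submodule.mem_top (x := h)))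
  refine algebra_le (B := compacts 𝓗) isClosed_setOfPred_isCompactOperator (fun S hS _ => ?_) hT
  have := (hS f (isClosed_tsupport _).isCompact).1
  rwa [hf, mul_one] at this

theorem not_subsingleton_K0 [Nonempty Y] (hρ : IsAmple ρ) :
    ¬ Subsingleton (KTheory.K0 (algebra ρ)) := fun hK => by
  obtain ⟨y⟩ := ‹Nonempty Y›
  obtain ⟨g, k, -, he⟩ := Wannier.exists_unit_vector hρ y one_pos
  set e := ρ g k with hek
  let P : 𝓗 →L[ℂ] 𝓗 := (Submodule.span ℂ {e}).starProjection
  have hP : IsStarProjection P := isStarProjection_starProjection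
  have hPe : P = (innerSL ℂ e).smulRight e := by
    ext h
    exact Submodule.starProjection_unit_singleton ℂ he h
  have hPc : IsCompactOperator P := by
    rw [hPe]
    exact isCompactOperator_rankOne e e
  have hmem : P ∈ algebra ρ := by
    refine mem_algebra (fun f _ => ⟨hPc.comp_clm (ρ f), hPc.clm_comp (ρ f)⟩)
      ⟨1, one_pos, fun f f' hff => ?_⟩
    by_cases hf : f y = 0
    · have : f = 0 := by
        ext z
        rwa [Subsingleton.elim z y]
      simp [this]
    · by_cases hf' : f' y = 0
      · have : f' = 0 := by
          ext z
          rwa [Subsingleton.elim z y]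
        simp [this]
      · have := hff y (subset_tsupport _ hf) y (subset_tsupport _ hf')
        rw [dist_self] at this
        exact absurd this (by norm_num)
  have hq : IsStarProjection (⟨P, hmem⟩ : algebra ρ) :=
    ⟨Subtype.ext hP.isIdempotentElem, Subtype.ext hP.isSelfAdjoint⟩
  have h0 := KTheory.eq_zero_of_K0_mk_eq_zero
    (fun a ha => isCompactOperator_of_mem_algebra hρ ha) (hq := hq) (Subsingleton.elim _ _)
  have h1 : P = 0 := congrArg Subtype.val h0
  have h2 : P e = e :=
    Submodule.starProjection_eq_self_iff.2 (Submodule.mem_span_singleton_self e)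
  rw [h1] at h2
  have h3 : (0 : 𝓗) = e := h2
  rw [← h3, norm_zero] at he
  exact zero_ne_one he

end Point

end Roe

theorem IsRiemannianManifold.preconnectedSpace {E H X : Type*} [NormedAddCommGroup E]
    [NormedSpace ℝ E] [TopologicalSpace H] (I : ModelWithCorners ℝ E H) [MetricSpace X]
    [ChartedSpace H X] [RiemannianBundle (fun x : X => TangentSpace I x)]
    [IsRiemannianManifold I X] : PreconnectedSpace X := by
  refine ⟨isPreconnected_of_forall_pair fun x _ y _ => ?_⟩
  have h : riemannianEDist I x y < ⊤ := by
    rw [← IsRiemannianManifold.out (I := I) x y]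
    exact edist_lt_top x y
  obtain ⟨γ, h₀, h₁, hγ, -⟩ := exists_lt_of_riemannianEDist_lt h
  exact ⟨γ '' Set.Icc 0 1, Set.subset_univ _, ⟨0, by simp, h₀⟩, ⟨1, by simp, h₁⟩,
    isPreconnected_Icc.image _ hγ.continuousOn⟩

end

theorem theorem3p5 {d : ℕ} {X : Type*} [MetricSpace X] [SecondCountableTopology X]
    [ChartedSpace (EuclideanSpace ℝ (Fin d)) X] [IsManifold (𝓡 d) ∞ X]
    [RiemannianBundle (fun x : X => TangentSpace (𝓡 d) x)]
    [IsContMDiffRiemannianBundle (𝓡 d) ∞ (EuclideanSpace ℝ (Fin d))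
      (fun x : X => TangentSpace (𝓡 d) x)]
    [IsRiemannianManifold (𝓡 d) X] [MeasurableSpace X] [BorelSpace X]
    (hgrowth : Wannier.PolynomialGrowth (RiemannianVolume.vol (d := d) X))
    (hballs : Wannier.SmallBallsBoundedBelow d (RiemannianVolume.vol (d := d) X))
    {X₁ X₂ : Set X} (hX₁ : IsClosed X₁) (hX₂ : IsClosed X₂) (hX : X₁ ∪ X₂ = Set.univ)
    {𝓗₁ : Type*} [NormedAddCommGroup 𝓗₁] [InnerProductSpace ℂ 𝓗₁] [CompleteSpace 𝓗₁]
    (ρ₁ : C₀(X₁, ℂ) →⋆ₙₐ[ℂ] (𝓗₁ →L[ℂ] 𝓗₁)) (hρ₁ : Roe.IsAmple ρ₁)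
    (hK₁ : Subsingleton (KTheory.K0 (Roe.algebra ρ₁)))
    {𝓗₂ : Type*} [NormedAddCommGroup 𝓗₂] [InnerProductSpace ℂ 𝓗₂] [CompleteSpace 𝓗₂]
    (ρ₂ : C₀(X₂, ℂ) →⋆ₙₐ[ℂ] (𝓗₂ →L[ℂ] 𝓗₂)) (hρ₂ : Roe.IsAmple ρ₂)
    (hK₂ : Subsingleton (KTheory.K0 (Roe.algebra ρ₂)))
    (p : Roe.algebra (Roe.mulRep (RiemannianVolume.vol (d := d) X))) (hp : IsStarProjection p)
    (hclass : KTheory.K0.mk p hp ≠ 0)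
    (Γ : Set X) (hΓ : Wannier.UniformlyDiscrete Γ) :
    ¬ ∃ w : Γ → Lp ℂ 2 (RiemannianVolume.vol (d := d) X),
      Wannier.IsLocalizedBasis (RiemannianVolume.vol (d := d) X) Γ
        (LinearMap.range (p : Lp ℂ 2 (RiemannianVolume.vol (d := d) X) →L[ℂ]
          Lp ℂ 2 (RiemannianVolume.vol (d := d) X)).toLinearMap) w := by
  rintro ⟨w, hw⟩
  have := ChartedSpace.locallyCompactSpace (EuclideanSpace ℝ (Fin d)) X
  have := IsRiemannianManifold.preconnectedSpace (X := X) (𝓡 d)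
  rcases subsingleton_or_nontrivial X with hsub | hnt
  · rcases isEmpty_or_nonempty X with hempty | ⟨⟨x⟩⟩
    · have hp0 : p = 0 := by
        refine Subtype.ext (ContinuousLinearMap.ext fun h => Lp.ext ?_)
        exact Filter.Eventually.of_forall fun x => isEmptyElim x
      exact hclass (KTheory.K0.mk_zero_eq_zero hp0)
    · rcases hX.symm.subset (Set.mem_univ x) with hx | hx
      · have : Nonempty X₁ := ⟨⟨x, hx⟩⟩
        exact Roe.not_subsingleton_K0 hρ₁ hK₁
      · have : Nonempty X₂ := ⟨⟨x, hx⟩⟩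
        exact Roe.not_subsingleton_K0 hρ₂ hK₂
  · have : ConnectedSpace X := ⟨inferInstance⟩
    exact hclass (Wannier.class_zero_of_isLocalizedBasis hgrowth hballs hX₁ hX₂ hX hρ₁ hK₁ hρ₂ hK₂
      p hp hΓ hw)
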